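/- Fix a function $h:\mathbb{R}\to\mathbb{R}$ such that $h$ is even, $h\in C^2$, $h(0)=h'(0)=h''(0)=0$, and $h''$ is strictly increasing, unbounded and concave on $[0,\infty)$. Consider the following perfect-information game between Forecaster, Skeptic and Reality (the unbounded forecasting game with quadratic and stronger hedges). Skeptic's capital starts at $\mathcal K_0=1$, and in each round $n=1,2,\dots$, in this order, Forecaster announces $m_n\in\mathbb{R}$, $v_n\ge0$, $w_n\ge0$; Skeptic announces $M_n,V_n,W_n\in\mathbb{R}$; Reality announces $x_n\in\mathbb{R}$; and $$\mathcal K_n=\mathcal K_{n-1}+M_n(x_n-m_n)+V_n\big((x_n-m_n)^2-v_n\big)+W_n\big(h(x_n-m_n)-w_n\big).$$ Forecaster must keep the game coherent: his announcement must be such that for every $(M_n,V_n,W_n)$ Reality has a move $x_n$ with $\mathcal K_n\le\mathcal K_{n-1}$. Skeptic is said to force an event $E$ (a property of the infinite sequence of moves of Forecaster and Reality) if he has a strategy, each move depending only on the announcements made before it, such that for all permitted moves of Forecaster and all moves of Reality, $\mathcal K_n\ge0$ for all $n$, and either $E$ happens or $\mathcal K_n\to\infty$. Put $A_n=\sum_{i=1}^n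 v_i$, $b_n=\sqrt{A_n/\ln\ln A_n}$ and $S_n=\sum_{i=1}^n x_i$ (in the condition and the conclusion below only the $n$ with $A_n>e$ are considered). **Proposition.** In this game Skeptic can force $$\Big(A_n\to\infty\ \text{ and }\ \sum_n\frac{w_n}{h(b_n)}<\infty\Big)\ \Longrightarrow\ \limsup_{n\to\infty}\frac{S_n-\sum_{i=1}^n m_i}{\sqrt{2A_n\ln\ln A_n}}\ge1 .$$ In particular, when $m_n=0$ for all $n$, the conclusion reads $\limsup_{n\to\infty}S_n/\sqrt{2A_n\ln\ln A_n}\ge1$. -/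

import Mathlib

open Filter Topology

noncomputable section

namespace UFQSH

/-- The conditions on the extra hedge `h`. -/
structure IsExtraHedge (h : ℝ → ℝ) : Prop where
  even : Function.Even h
  contDiff : ContDiff ℝ 2 h
  map_zero : h 0 = 0
  deriv_zero : deriv h 0 = 0
  deriv2_zero : deriv (deriv h) 0 = 0
  strictMonoOn : StrictMonoOn (deriv (deriv h)) (Set.Ici 0)
  unbounded : ∀ B : ℝ, ∃ x : ℝ, 0 ≤ x ∧ B < deriv (deriv h) x
  concaveOn : ConcaveOn ℝ (Set.Ici 0) (deriv (deriv h))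

/-- Forecaster's announcement in one round: the prices of `x - m`, `(x - m) ^ 2`, `h (x - m)`
are `0`, `v`, `w`. -/
structure ForecasterMove where
  m : ℝ
  v : ℝ
  w : ℝ

/-- Skeptic's announcement in one round. -/
structure SkepticMove where
  M : ℝ
  V : ℝ
  W : ℝ

/-- The increment of Skeptic's capital in one round in which Forecaster announces `f`,
Skeptic announces `s` and Reality announces `x`. -/
def gain (h : ℝ → ℝ) (f : ForecasterMove) (s : SkepticMove) (x : ℝ) : ℝ :=
  s.M * (x - f.m) + s.V * ((x - f.m) ^ 2 - f.v) + s.W * (h (x - f.m) - f.w)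

/-- A move of Forecaster keeps the game coherent if, whatever Skeptic announces, Reality has
a move that does not increase Skeptic's capital. -/
def ForecasterMove.IsCoherent (h : ℝ → ℝ) (f : ForecasterMove) : Prop :=
  ∀ s : SkepticMove, ∃ x : ℝ, gain h f s x ≤ 0

/-- A move permitted to Forecaster by the protocol and by his collateral duty. -/
def ForecasterMove.IsLegal (h : ℝ → ℝ) (f : ForecasterMove) : Prop :=
  0 ≤ f.v ∧ 0 ≤ f.w ∧ f.IsCoherent h

/-- A strategy for Skeptic. The rounds are numbered `0, 1, 2, …`; `f n` and `x n` are the moves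
of Forecaster and of Reality in round `n`. Skeptic's move in round `n` may depend only on
what has been announced before it: on `f 0, …, f n` and on `x 0, …, x (n - 1)`. -/
structure SkepticStrategy where
  move : (ℕ → ForecasterMove) → (ℕ → ℝ) → ℕ → SkepticMove
  nonanticipating : ∀ (f f' : ℕ → ForecasterMove) (x x' : ℕ → ℝ) (n : ℕ),
    (∀ i ≤ n, f i = f' i) → (∀ i < n, x i = x' i) → move f x n = move f' x' n

/-- Skeptic's capital after `n` rounds, starting from `1`. -/
def capital (h : ℝ → ℝ) (σ : SkepticStrategy) (f : ℕ → ForecasterMove) (x : ℕ → ℝ) : ℕ → ℝ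
  | 0 => 1
  | n + 1 => capital h σ f x n + gain h (f n) (σ.move f x n) (x n)

/-- Skeptic can force the event `E`: he has a strategy such that, for all legal moves of
Forecaster and all moves of Reality, his capital stays nonnegative, and either `E` happens or his
capital tends to infinity. -/
def CanForce (h : ℝ → ℝ) (E : (ℕ → ForecasterMove) → (ℕ → ℝ) → Prop) : Prop :=
  ∃ σ : SkepticStrategy, ∀ (f : ℕ → ForecasterMove) (x : ℕ → ℝ), (∀ n, (f n).IsLegal h) →
    (∀ n, 0 ≤ capital h σ f x n) ∧ (E f x ∨ Tendsto (capital h σ f x) atTop atTop)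

/-- `A f n` is the sum of `v` over the first `n` rounds. -/
def A (f : ℕ → ForecasterMove) (n : ℕ) : ℝ :=
  ∑ i ∈ Finset.range n, (f i).v

/-- `b f n` is `√(A_n / ln ln A_n)`, meaningful as soon as `A_n > e`. -/
def b (f : ℕ → ForecasterMove) (n : ℕ) : ℝ :=
  √(A f n / Real.log (Real.log (A f n)))

/-- `S f x n` is the sum of `x - m` over the first `n` rounds. -/
def S (f : ℕ → ForecasterMove) (x : ℕ → ℝ) (n : ℕ) : ℝ :=
  ∑ i ∈ Finset.range n, (x i - (f i).m)

end UFQSH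

end

namespace UFQSH

/-! Time is cut into stages in which `A` grows from about $e^{\lambda k}$ to $T=e^{\lambda(k+1)}$;
let $s$ and $a$ be the sums of deviations and of variances over the rounds bet on in a stage.
Measured in units of `b`, the hedge dominates a cube for small deviations, and by coherence
(`hedge_le`) its price dominates the cube of $\sqrt v$. Hence a second-order Taylor bet with
exponent $\theta$, corrected by $\pm40$ normalized hedges, yields a product that lies above (sign
$+$) or below (sign $-$) $e^{\theta s-\theta^2a/2}$ up to a constant factor, as long as deviations
are at most `b / 2`.

With $\kappa\approx\sqrt{2\ln k/T}$, Skeptic sells the product for $\kappa$ and buys a third of each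
product for $\kappa(1\pm\delta)$. The sold product can dominate the bought ones only when
$s\approx\kappa a$, and there it is at most $Ck$ (`peak_le`), so a stake of order $1/k$ is safe. If
$s\le(1-5\delta)\sqrt{2T\ln k}$ at the end of a late regular stage, the combination is nonpositive
(`peak_nonpos`) and the capital has been multiplied by at least $1+1/(6Ck)$. Since $\sum1/k$
diverges, infinitely many stages must have a larger increment (`canForceFrom_increment`).

Two auxiliary strategies complete the argument. Buying the hedge forces its normalized payoffs to be
summable when its prices are, so late stages are never interrupted; summably weighted bets on
decrements force $s\ge-3\sqrt{T\ln k}$ in late stages (`canForceFrom_decrement`). Because stages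
grow by a huge ratio, the past is negligible against one large increment. The limit superior is thus
at least $1-O(\delta)$, and mixing over $\delta=1/(j+10)$ gives 1. -/

/-! ### Scaling of the hedge and its price under coherence. -/

theorem nonneg_of_second_deriv_nonneg {g g' g'' : ℝ → ℝ} (h1 : ∀ x, HasDerivAt g (g' x) x)
    (h2 : ∀ x, HasDerivAt g' (g'' x) x) (h0 : g 0 = 0) (h0' : g' 0 = 0)
    (hpos : ∀ x, 0 ≤ x → 0 ≤ g'' x) {x : ℝ} (hx : 0 ≤ x) : 0 ≤ g x := by
  have key : ∀ {p q : ℝ → ℝ}, (∀ x, HasDerivAt p (q x) x) → p 0 = 0 → (∀ x, 0 ≤ x → 0 ≤ q x) →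
      ∀ x, 0 ≤ x → 0 ≤ p x := by
    intro p q hd hp hq x hx
    have hm : MonotoneOn p (Set.Ici 0) := by
      refine monotoneOn_of_deriv_nonneg (convex_Ici 0)
        (fun y _ => (hd y).continuousAt.continuousWithinAt)
        (fun y _ => (hd y).differentiableAt.differentiableWithinAt) ?_
      intro y hy
      rw [interior_Ici] at hy
      rw [(hd y).deriv]
      exact hq y (le_of_lt hy)
    have := hm (Set.mem_Ici.2 le_rfl) (Set.mem_Ici.2 hx) hx
    rwa [hp] at this
  exact key h1 h0 (key h2 h0' hpos) x hx

namespace IsExtraHedge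

variable {h : ℝ → ℝ}

theorem hasDerivAt (hh : IsExtraHedge h) (x : ℝ) : HasDerivAt h (deriv h x) x :=
  (hh.contDiff.differentiable (by norm_num) x).hasDerivAt

theorem hasDerivAt_deriv (hh : IsExtraHedge h) (x : ℝ) :
    HasDerivAt (deriv h) (deriv (deriv h) x) x := by
  have h2 : ContDiff ℝ 1 (deriv h) := by
    have : ContDiff ℝ (1 + 1) h := by simpa [one_add_one_eq_two] using hh.contDiff
    exact (contDiff_succ_iff_deriv.1 this).2.2
  exact (h2.differentiable (by norm_num) x).hasDerivAt

theorem hasDerivAt_comp_mul (hh : IsExtraHedge h) (c x : ℝ) :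
    HasDerivAt (fun x => h (c * x)) (c * deriv h (c * x)) x := by
  exact ((hh.hasDerivAt (c * x)).comp x ((hasDerivAt_id x).const_mul c)).congr_deriv
    (by rw [mul_one, mul_comm])

theorem hasDerivAt_deriv_comp_mul (hh : IsExtraHedge h) (c x : ℝ) :
    HasDerivAt (fun x => c * deriv h (c * x)) (c ^ 2 * deriv (deriv h) (c * x)) x := by
  exact (((hh.hasDerivAt_deriv (c * x)).comp x ((hasDerivAt_id x).const_mul c)).const_mul
    c).congr_deriv (by ring)

/-- Concavity and `h'' 0 = 0` give `c * h'' y ≤ h'' (c * y)`; differentiating `h (c * x)` twice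
supplies the other factor `c ^ 2`. -/
theorem cube_mul_le (hh : IsExtraHedge h) {c x : ℝ} (hc : 0 ≤ c) (hc1 : c ≤ 1) (hx : 0 ≤ x) :
    c ^ 3 * h x ≤ h (c * x) := by
  have := nonneg_of_second_deriv_nonneg (g := fun x => h (c * x) - c ^ 3 * h x)
    (fun x => (hh.hasDerivAt_comp_mul c x).sub ((hh.hasDerivAt x).const_mul (c ^ 3)))
    (fun x => (hh.hasDerivAt_deriv_comp_mul c x).sub ((hh.hasDerivAt_deriv x).const_mul (c ^ 3)))
    (by simp [hh.map_zero]) (by simp [hh.deriv_zero]) ?_ hx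
  · simpa using this
  · intro y hy
    have h1 := hh.concaveOn.2 (Set.mem_Ici.2 hy) (Set.mem_Ici.2 (le_refl (0 : ℝ))) hc
      (sub_nonneg.2 hc1) (by ring)
    simp only [smul_eq_mul, hh.deriv2_zero, mul_zero, add_zero] at h1
    nlinarith [mul_le_mul_of_nonneg_left h1 (sq_nonneg c)]

/-- Here only monotonicity of `h''` is needed: `h'' (c * y) ≤ h'' y`. -/
theorem le_sq_mul (hh : IsExtraHedge h) {c x : ℝ} (hc : 0 ≤ c) (hc1 : c ≤ 1) (hx : 0 ≤ x) :
    h (c * x) ≤ c ^ 2 * h x := by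
  have := nonneg_of_second_deriv_nonneg (g := fun x => c ^ 2 * h x - h (c * x))
    (fun x => ((hh.hasDerivAt x).const_mul (c ^ 2)).sub (hh.hasDerivAt_comp_mul c x))
    (fun x => ((hh.hasDerivAt_deriv x).const_mul (c ^ 2)).sub (hh.hasDerivAt_deriv_comp_mul c x))
    (by simp [hh.map_zero]) (by simp [hh.deriv_zero]) ?_ hx
  · simpa using this
  · intro y hy
    have hcy : c * y ≤ y := by nlinarith
    have h1 := hh.strictMonoOn.monotoneOn (Set.mem_Ici.2 (mul_nonneg hc hy)) (Set.mem_Ici.2 hy) hcy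
    nlinarith [mul_le_mul_of_nonneg_left h1 (sq_nonneg c)]

theorem abs_eq (hh : IsExtraHedge h) (x : ℝ) : h |x| = h x := by
  rcases abs_choice x with hx | hx <;> rw [hx]
  exact hh.even x

theorem nonneg (hh : IsExtraHedge h) (x : ℝ) : 0 ≤ h x := by
  rw [← hh.abs_eq]
  refine nonneg_of_second_deriv_nonneg hh.hasDerivAt hh.hasDerivAt_deriv hh.map_zero hh.deriv_zero
    (fun y hy => ?_) (abs_nonneg x)
  have := hh.strictMonoOn.monotoneOn (Set.mem_Ici.2 (le_refl (0 : ℝ))) (Set.mem_Ici.2 hy) hy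
  rwa [hh.deriv2_zero] at this

theorem pos (hh : IsExtraHedge h) {x : ℝ} (hx : 0 < x) : 0 < h x := by
  refine lt_of_le_of_ne (hh.nonneg x) fun h0 => ?_
  have hzero : ∀ y ∈ Set.Ioo 0 x, h y = 0 := by
    intro y hy
    have h1 : y / x ≤ 1 := (div_le_one hx).2 hy.2.le
    have h2 := hh.le_sq_mul (div_nonneg hy.1.le hx.le) h1 hx.le
    rw [← h0, mul_zero, div_mul_cancel₀ _ hx.ne'] at h2
    exact le_antisymm h2 (hh.nonneg y)
  have hev : ∀ y ∈ Set.Ioo 0 x, deriv h y = 0 := by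
    intro y hy
    have : h =ᶠ[𝓝 y] fun _ => (0 : ℝ) := by
      filter_upwards [isOpen_Ioo.mem_nhds hy] with z hz using hzero z hz
    rw [this.deriv_eq]; simp
  have hev2 : deriv (deriv h) (x / 2) = 0 := by
    have : deriv h =ᶠ[𝓝 (x / 2)] fun _ => (0 : ℝ) := by
      filter_upwards [isOpen_Ioo.mem_nhds (show x / 2 ∈ Set.Ioo 0 x by constructor <;> linarith)]
        with z hz using hev z hz
    rw [this.deriv_eq]; simp
  have := hh.strictMonoOn (Set.mem_Ici.2 (le_refl (0 : ℝ))) (Set.mem_Ici.2 (by linarith))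
    (show (0 : ℝ) < x / 2 by linarith)
  rw [hh.deriv2_zero, hev2] at this
  exact lt_irrefl _ this

/-- Below the reference point, `h` is at least cubic. -/
theorem cube_le_div (hh : IsExtraHedge h) {B y : ℝ} (hB : 0 < B) (hy : |y| ≤ B) :
    (|y| / B) ^ 3 ≤ h y / h B := by
  rw [le_div_iff₀ (hh.pos hB), ← hh.abs_eq y]
  have := hh.cube_mul_le (div_nonneg (abs_nonneg y) hB.le) ((div_le_one hB).2 hy) hB.le
  rwa [div_mul_cancel₀ _ hB.ne'] at this

/-- Above the reference point, `h` is at least quadratic. -/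
theorem sq_le_div (hh : IsExtraHedge h) {B y : ℝ} (hB : 0 < B) (hy : B ≤ |y|) :
    (|y| / B) ^ 2 ≤ h y / h B := by
  have hy0 : 0 < |y| := hB.trans_le hy
  rw [le_div_iff₀ (hh.pos hB), ← hh.abs_eq y]
  have := hh.le_sq_mul (div_nonneg hB.le hy0.le) ((div_le_one hy0).2 hy) hy0.le
  rw [div_mul_cancel₀ _ hy0.ne'] at this
  calc (|y| / B) ^ 2 * h B ≤ (|y| / B) ^ 2 * ((B / |y|) ^ 2 * h |y|) := by gcongr
    _ = h |y| := by field_simp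

end IsExtraHedge

/-- Coherence makes the hedge at least as expensive, up to a constant, as its value at the
standard deviation. -/
theorem ForecasterMove.IsLegal.hedge_le {h : ℝ → ℝ} (hh : IsExtraHedge h) {f : ForecasterMove}
    (hf : f.IsLegal h) : 3 / 4 * h √f.v ≤ f.w := by
  obtain ⟨hv, hw, hc⟩ := hf
  rcases hv.eq_or_lt with hv0 | hv0
  · rw [← hv0, Real.sqrt_zero, hh.map_zero]; simpa using hw
  have ha : 0 < √f.v := Real.sqrt_pos.2 hv0
  have hha := hh.pos ha
  -- Against one hedge, sell just enough of the quadratic to cancel quadratic growth. With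
  -- $t=|y|/\sqrt v$, the hedge pays at least $h(\sqrt v)\min(t^2,t^3)$, and $t^2-t^3\le4/27<1/4$ on
  -- $[0,1]$; this is the source of the constant $3/4$.
  obtain ⟨x, hx⟩ := hc ⟨0, -(h √f.v / f.v), 1⟩
  simp only [gain] at hx
  set y := x - f.m
  have hsq : √f.v ^ 2 = f.v := Real.sq_sqrt hv
  have key : h √f.v * ((|y| / √f.v) ^ 2 - 1 / 4) ≤ h y := by
    set t := |y| / √f.v with ht
    have ht0 : 0 ≤ t := by positivity
    rcases le_total |y| √f.v with hle | hle
    · have h1 := hh.cube_le_div ha hle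
      rw [le_div_iff₀ hha] at h1
      have ht1 : t ≤ 1 := (div_le_one ha).2 hle
      have : t ^ 2 - 1 / 4 ≤ t ^ 3 := by
        nlinarith [mul_nonneg ht0 (sq_nonneg (t - 1 / 2)), sq_nonneg (t - 1 / 2)]
      nlinarith
    · have h1 := hh.sq_le_div ha hle
      rw [le_div_iff₀ hha] at h1
      nlinarith
  rw [div_pow, hsq, sq_abs] at key
  have e1 : h √f.v / f.v * f.v = h √f.v := div_mul_cancel₀ _ hv0.ne'
  have e2 : h √f.v / f.v * y ^ 2 = h √f.v * (y ^ 2 / f.v) := by ring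
  nlinarith

/-! ### Second-order exponential bounds with cubic errors paid by the hedge. -/

theorem abs_exp_sub_taylor_two_le {z : ℝ} (hz : |z| ≤ 1) :
    |Real.exp z - (1 + z + z ^ 2 / 2)| ≤ 2 / 9 * |z| ^ 3 := by
  have h3 := Real.exp_bound hz (n := 3) (by norm_num)
  simp only [Finset.sum_range_succ, Finset.sum_range_zero, Nat.factorial] at h3
  norm_num at h3
  linarith

theorem sq_mul_le_cube_add_cube {g t : ℝ} (hg : 0 ≤ g) (ht : 0 ≤ t) :
    g ^ 2 * t ≤ g ^ 3 + t ^ 3 := by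
  rcases le_total g t with h | h
  · have : g ^ 2 * t ≤ t ^ 2 * t := by gcongr
    nlinarith [pow_nonneg hg 3]
  · have : g ^ 2 * t ≤ g ^ 2 * g := by gcongr
    nlinarith [pow_nonneg ht 3]

/-- In the application `z` is $\theta y$, `g` is $|\theta|\sqrt v$, and `u`, `ρ` are the normalized
payoff and price. The errors are the Taylor remainder and the cross term $g^2(e^z-1)$, of size at
most $2(g^3+|z|^3)$; the terms in `u` and `ρ` absorb both. -/
theorem taylor_sub_hedge_le_exp {z g u ρ : ℝ} (hz : |z| ≤ 1) (hg : 0 ≤ g)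
    (hzu : |z| ^ 3 ≤ 8 * u) (hgρ : g ^ 3 ≤ 11 * ρ) :
    1 + z + z ^ 2 / 2 - g ^ 2 / 2 - 40 * (u - ρ) ≤ Real.exp (z - g ^ 2 / 2 + 400 * ρ) := by
  have hρ : 0 ≤ ρ := by nlinarith [pow_nonneg hg 3]
  have hu : 0 ≤ u := by nlinarith [pow_nonneg (abs_nonneg z) 3]
  have h1 := (abs_le.1 (abs_exp_sub_taylor_two_le hz)).1
  have h2 := (abs_le.1 (Real.abs_exp_sub_one_le hz)).2
  have h3 := sq_mul_le_cube_add_cube hg (abs_nonneg z)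
  have h4 : 1 / 3 ≤ Real.exp z := by
    have : Real.exp (-1) ≤ Real.exp z := Real.exp_le_exp.2 (by linarith [(abs_le.1 hz).1])
    have := Real.exp_neg_one_gt_d9
    linarith
  have h5 : g ^ 2 * (Real.exp z - 1) ≤ g ^ 2 * (2 * |z|) := by gcongr
  have h6 : 1 / 3 * ρ ≤ Real.exp z * ρ := by gcongr
  have h7 : Real.exp z * (1 + (-(g ^ 2 / 2) + 400 * ρ)) ≤ Real.exp (z - g ^ 2 / 2 + 400 * ρ) := by
    rw [show z - g ^ 2 / 2 + 400 * ρ = z + (-(g ^ 2 / 2) + 400 * ρ) by ring, Real.exp_add]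
    gcongr
    linarith [Real.add_one_le_exp (-(g ^ 2 / 2) + 400 * ρ)]
  nlinarith

theorem exp_le_taylor_add_hedge {z g u ρ : ℝ} (hz : |z| ≤ 1) (hg : 0 ≤ g)
    (hzu : |z| ^ 3 ≤ 8 * u) (hgρ : g ^ 3 ≤ 11 * ρ) (hρ1 : ρ ≤ 1 / 100000) :
    Real.exp (z - g ^ 2 / 2 - 400 * ρ) ≤ 1 + z + z ^ 2 / 2 - g ^ 2 / 2 + 40 * (u - ρ) := by
  have hρ : 0 ≤ ρ := by nlinarith [pow_nonneg hg 3]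
  have hu : 0 ≤ u := by nlinarith [pow_nonneg (abs_nonneg z) 3]
  have hg1 : g ≤ 1 := by
    by_contra hlt
    nlinarith [one_lt_pow₀ (not_le.1 hlt) (n := 3) (by norm_num)]
  have h1 := (abs_le.1 (abs_exp_sub_taylor_two_le hz)).2
  have h2 := (abs_le.1 (Real.abs_exp_sub_one_le hz)).1
  have h3 := sq_mul_le_cube_add_cube hg (abs_nonneg z)
  have h4 : 1 / 3 ≤ Real.exp z := by
    have : Real.exp (-1) ≤ Real.exp z := Real.exp_le_exp.2 (by linarith [(abs_le.1 hz).1])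
    have := Real.exp_neg_one_gt_d9
    linarith
  have h4' : Real.exp z ≤ 3 := by
    have : Real.exp z ≤ Real.exp 1 := Real.exp_le_exp.2 (abs_le.1 hz).2
    have := Real.exp_one_lt_d9
    linarith
  have h5 : g ^ 2 * (-(2 * |z|)) ≤ g ^ 2 * (Real.exp z - 1) := by gcongr
  have h6 : 1 / 3 * ρ ≤ Real.exp z * ρ := by gcongr
  set t := g ^ 2 / 2 + 400 * ρ with ht
  have ht0 : 0 ≤ t := by positivity
  have hexp : Real.exp (-t) ≤ 1 - t + t ^ 2 := by
    have ha : Real.exp (-t) * (1 + t) ≤ 1 := by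
      calc Real.exp (-t) * (1 + t) ≤ Real.exp (-t) * Real.exp t := by
            gcongr; linarith [Real.add_one_le_exp t]
        _ = 1 := by rw [← Real.exp_add]; simp
    have hb : (1 : ℝ) ≤ (1 - t + t ^ 2) * (1 + t) := by nlinarith [pow_nonneg ht0 3]
    exact le_of_mul_le_mul_right (ha.trans hb) (by linarith)
  -- This is the point where `ρ` has to be small: the quadratic error of $e^{-t}$ must be linear in
  -- `ρ`.
  have ht2 : t ^ 2 ≤ 9 * ρ := by
    have hg4 : g ^ 4 ≤ 11 * ρ := by nlinarith [pow_nonneg hg 3]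
    have hr2 : ρ ^ 2 ≤ ρ * (1 / 100000) := by nlinarith
    nlinarith [sq_nonneg (g ^ 2 / 2 - 400 * ρ)]
  have h7 : Real.exp (z - g ^ 2 / 2 - 400 * ρ) ≤ Real.exp z * (1 - t) + 3 * (9 * ρ) := by
    rw [show z - g ^ 2 / 2 - 400 * ρ = z + -t by rw [ht]; ring, Real.exp_add]
    have h8 : Real.exp z * Real.exp (-t) ≤ Real.exp z * (1 - t + t ^ 2) := by gcongr
    have h9 : Real.exp z * t ^ 2 ≤ 3 * (9 * ρ) := by
      apply mul_le_mul h4' (by linarith) (sq_nonneg t) (by norm_num)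
    linarith
  nlinarith

/-! ### Betting factors in a single round. -/

/-- The deviation of Reality's move from its price. -/
noncomputable def dev (f : ℕ → ForecasterMove) (x : ℕ → ℝ) (i : ℕ) : ℝ := x i - (f i).m

/-- The normalized price of the extra hedge. -/
noncomputable def rho (h : ℝ → ℝ) (f : ℕ → ForecasterMove) (i : ℕ) : ℝ :=
  (f i).w / h (b f (i + 1))

/-- The normalized payoff of the extra hedge. -/
noncomputable def payoff (h : ℝ → ℝ) (f : ℕ → ForecasterMove) (x : ℕ → ℝ) (i : ℕ) : ℝ :=
  h (dev f x i) / h (b f (i + 1))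

/-- The factor by which capital is multiplied in round `i` if a unit stake follows the
second-order Taylor expansion of `exp (θ * y)`, together with `c` units of the normalized hedge. -/
noncomputable def fac (h : ℝ → ℝ) (f : ℕ → ForecasterMove) (x : ℕ → ℝ) (θ c : ℝ) (i : ℕ) : ℝ :=
  1 + θ * dev f x i + (θ * dev f x i) ^ 2 / 2 - θ ^ 2 * (f i).v / 2
    + c * (payoff h f x i - rho h f i)

section Round

variable {h : ℝ → ℝ} {f : ℕ → ForecasterMove} {x : ℕ → ℝ} {θ : ℝ} {i : ℕ}

theorem rho_nonneg (hh : IsExtraHedge h) (hf : (f i).IsLegal h) : 0 ≤ rho h f i :=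
  div_nonneg hf.2.1 (hh.nonneg _)

theorem payoff_nonneg (hh : IsExtraHedge h) : 0 ≤ payoff h f x i :=
  div_nonneg (hh.nonneg _) (hh.nonneg _)

/-- If $\sqrt v$ exceeded `b`, quadratic growth would push the normalized price above $1/2$; so the
cubic regime applies. -/
theorem cube_sqrt_div_le (hh : IsExtraHedge h) (hf : (f i).IsLegal h) (hB : 0 < b f (i + 1))
    (hρ : rho h f i ≤ 1 / 2) : (√(f i).v / b f (i + 1)) ^ 3 ≤ 4 / 3 * rho h f i := by
  have h1 : h √(f i).v / h (b f (i + 1)) ≤ 4 / 3 * rho h f i := by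
    rw [rho, ← mul_div_assoc]
    gcongr
    · exact hh.nonneg _
    · linarith [hf.hedge_le hh]
  have habs : |√(f i).v| = √(f i).v := abs_of_nonneg (Real.sqrt_nonneg _)
  rcases le_total √(f i).v (b f (i + 1)) with hle | hle
  · have := hh.cube_le_div hB (y := √(f i).v) (by rwa [habs])
    rw [habs] at this
    linarith
  · have := hh.sq_le_div hB (y := √(f i).v) (by rwa [habs])
    rw [habs] at this
    have h2 : 1 ≤ √(f i).v / b f (i + 1) := (one_le_div hB).2 hle
    nlinarith

theorem cube_theta_sqrt_le (hh : IsExtraHedge h) (hf : (f i).IsLegal h) (hB : 0 < b f (i + 1))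
    (hθ : |θ| * b f (i + 1) ≤ 2) (hρ : rho h f i ≤ 1 / 2) :
    (|θ| * √(f i).v) ^ 3 ≤ 11 * rho h f i := by
  have h1 := cube_sqrt_div_le hh hf hB hρ
  have h2 : |θ| * √(f i).v ≤ 2 * (√(f i).v / b f (i + 1)) := by
    calc |θ| * √(f i).v = |θ| * b f (i + 1) * (√(f i).v / b f (i + 1)) := by field_simp
      _ ≤ _ := by gcongr
  calc (|θ| * √(f i).v) ^ 3 ≤ (2 * (√(f i).v / b f (i + 1))) ^ 3 := by gcongr
    _ = 8 * (√(f i).v / b f (i + 1)) ^ 3 := by ring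
    _ ≤ 11 * rho h f i := by linarith [rho_nonneg hh hf]

theorem theta_sqrt_sq (hf : (f i).IsLegal h) : (|θ| * √(f i).v) ^ 2 = θ ^ 2 * (f i).v := by
  rw [mul_pow, sq_abs, Real.sq_sqrt hf.1]

theorem abs_theta_mul_le (hB : 0 < b f (i + 1)) (hθ : |θ| * b f (i + 1) ≤ 2) (y : ℝ) :
    |θ * y| ≤ 2 * (|y| / b f (i + 1)) := by
  rw [abs_mul]
  calc |θ| * |y| = |θ| * b f (i + 1) * (|y| / b f (i + 1)) := by field_simp
    _ ≤ _ := by gcongr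

theorem abs_theta_dev_le_one (hB : 0 < b f (i + 1)) (hθ : |θ| * b f (i + 1) ≤ 2)
    (hy : |dev f x i| ≤ b f (i + 1) / 2) : |θ * dev f x i| ≤ 1 := by
  refine (abs_theta_mul_le hB hθ _).trans ?_
  have : |dev f x i| / b f (i + 1) ≤ 1 / 2 := by
    rw [div_le_iff₀ hB]; linarith
  linarith

theorem cube_theta_dev_le (hh : IsExtraHedge h) (hB : 0 < b f (i + 1))
    (hθ : |θ| * b f (i + 1) ≤ 2) (hy : |dev f x i| ≤ b f (i + 1) / 2) :
    |θ * dev f x i| ^ 3 ≤ 8 * payoff h f x i := by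
  have h1 := hh.cube_le_div hB (y := dev f x i) (by linarith)
  calc |θ * dev f x i| ^ 3 ≤ (2 * (|dev f x i| / b f (i + 1))) ^ 3 := by
        gcongr; exact abs_theta_mul_le hB hθ _
    _ = 8 * (|dev f x i| / b f (i + 1)) ^ 3 := by ring
    _ ≤ 8 * payoff h f x i := by unfold payoff; linarith

theorem fac_le_exp (hh : IsExtraHedge h) (hf : (f i).IsLegal h) (hB : 0 < b f (i + 1))
    (hθ : |θ| * b f (i + 1) ≤ 2) (hρ : rho h f i ≤ 1 / 100000)
    (hy : |dev f x i| ≤ b f (i + 1) / 2) :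
    fac h f x θ (-40) i ≤
      Real.exp (θ * dev f x i - θ ^ 2 / 2 * (f i).v + 400 * rho h f i) := by
  have := taylor_sub_hedge_le_exp (abs_theta_dev_le_one hB hθ hy) (by positivity)
    (cube_theta_dev_le hh hB hθ hy) (cube_theta_sqrt_le hh hf hB hθ (by linarith))
  rw [theta_sqrt_sq hf] at this
  rw [show θ ^ 2 / 2 * (f i).v = θ ^ 2 * (f i).v / 2 by ring]
  unfold fac
  linarith

theorem exp_le_fac (hh : IsExtraHedge h) (hf : (f i).IsLegal h) (hB : 0 < b f (i + 1))
    (hθ : |θ| * b f (i + 1) ≤ 2) (hρ : rho h f i ≤ 1 / 100000)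
    (hy : |dev f x i| ≤ b f (i + 1) / 2) :
    Real.exp (θ * dev f x i - θ ^ 2 / 2 * (f i).v - 400 * rho h f i) ≤ fac h f x θ 40 i := by
  have := exp_le_taylor_add_hedge (abs_theta_dev_le_one hB hθ hy) (by positivity)
    (cube_theta_dev_le hh hB hθ hy) (cube_theta_sqrt_le hh hf hB hθ (by linarith)) hρ
  rw [theta_sqrt_sq hf] at this
  rw [show θ ^ 2 / 2 * (f i).v = θ ^ 2 * (f i).v / 2 by ring]
  unfold fac
  linarith

/-- The 40 sold hedges make the factor negative once the deviation exceeds `b / 2`: with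
$t=|y|/b>1/2$ the payoff is at least $t^2/2$, and $20t^2$ outweighs $1+2t+2t^2$. Positivity of the
main factor therefore certifies the range in which all exponential estimates hold. -/
theorem abs_dev_le_of_fac_pos (hh : IsExtraHedge h) (hf : (f i).IsLegal h) (hB : 0 < b f (i + 1))
    (hθ : |θ| * b f (i + 1) ≤ 2) (hρ : rho h f i ≤ 1 / 100000)
    (hpos : 0 < fac h f x θ (-40) i) : |dev f x i| ≤ b f (i + 1) / 2 := by
  by_contra hlt
  rw [not_le] at hlt
  set t := |dev f x i| / b f (i + 1) with ht
  have ht2 : 1 / 2 < t := by rw [ht, lt_div_iff₀ hB]; linarith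
  have hu : t ^ 2 / 2 ≤ payoff h f x i := by
    rcases le_total |dev f x i| (b f (i + 1)) with hle | hle
    · have := hh.cube_le_div hB hle
      rw [← ht] at this
      unfold payoff
      nlinarith [sq_nonneg t]
    · have := hh.sq_le_div hB hle
      rw [← ht] at this
      unfold payoff
      nlinarith [sq_nonneg t]
  have hz := abs_theta_mul_le hB hθ (dev f x i)
  rw [← ht] at hz
  have hz1 := (abs_le.1 hz).2
  have hz2 : (θ * dev f x i) ^ 2 ≤ (2 * t) ^ 2 := sq_le_sq' (abs_le.1 hz).1 (abs_le.1 hz).2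
  have hv : 0 ≤ θ ^ 2 * (f i).v := mul_nonneg (sq_nonneg _) hf.1
  unfold fac at hpos
  nlinarith

theorem theta_sq_mul_le (hh : IsExtraHedge h) (hf : (f i).IsLegal h) (hB : 0 < b f (i + 1))
    (hθ : |θ| * b f (i + 1) ≤ 2) (hρ : rho h f i ≤ 1 / 100000) :
    θ ^ 2 * (f i).v ≤ 1 / 100 := by
  have h1 := cube_theta_sqrt_le hh hf hB hθ (by linarith)
  rw [← theta_sqrt_sq hf]
  set g := |θ| * √(f i).v
  have hg : 0 ≤ g := by positivity
  have : g ≤ 1 / 10 := by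
    by_contra hlt
    have : (1 / 10 : ℝ) ^ 3 < g ^ 3 := by gcongr; exact not_le.1 hlt
    linarith
  nlinarith

/-- The Taylor part is $\frac12+\frac12(1+\theta y)^2\ge\frac12$, which leaves room for the small
costs. -/
theorem fac_nonneg (hh : IsExtraHedge h) (hf : (f i).IsLegal h) (hB : 0 < b f (i + 1))
    (hθ : |θ| * b f (i + 1) ≤ 2) (hρ : rho h f i ≤ 1 / 100000) : 0 ≤ fac h f x θ 40 i := by
  have h1 := theta_sq_mul_le hh hf hB hθ hρ
  have h2 : 0 ≤ payoff h f x i := payoff_nonneg hh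
  unfold fac
  nlinarith [sq_nonneg (1 + θ * dev f x i)]

theorem fac_pos_of_payoff_le (hh : IsExtraHedge h) (hf : (f i).IsLegal h) (hB : 0 < b f (i + 1))
    (hθ : |θ| * b f (i + 1) ≤ 2) (hρ : rho h f i ≤ 1 / 100000)
    (hu : payoff h f x i ≤ 1 / 1000) : 0 < fac h f x θ (-40) i := by
  have h1 := theta_sq_mul_le hh hf hB hθ hρ
  have h2 : 0 ≤ rho h f i := rho_nonneg hh hf
  unfold fac
  nlinarith [sq_nonneg (1 + θ * dev f x i)]

end Round

/-! ### Stages of geometric growth of `A` and the exponents used in them. -/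

/-- The precision of the strategy with number `j`. -/
noncomputable def delta (j : ℕ) : ℝ := 1 / (j + 10)

/-- The logarithm of the ratio between the ends of successive stages. -/
noncomputable def lam (j : ℕ) : ℝ := 40 * (j + 10)

/-- The stage to which round `i` belongs. -/
noncomputable def stage (j : ℕ) (f : ℕ → ForecasterMove) (i : ℕ) : ℕ :=
  ⌊Real.log (A f (i + 1)) / lam j⌋₊

/-- The upper end of stage `k`. -/
noncomputable def horizon (j k : ℕ) : ℝ := Real.exp (lam j * (k + 1))

/-- The order of magnitude of the stakes in stage `k`. -/
noncomputable def scale (j k : ℕ) : ℝ := √(Real.log k / horizon j k)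

/-- The exponent to which the strategy is tuned in stage `k`. -/
noncomputable def kappa (j k : ℕ) : ℝ := (1 - delta j) * (√2 * scale j k)

theorem delta_pos (j : ℕ) : 0 < delta j := by unfold delta; positivity

theorem delta_le (j : ℕ) : delta j ≤ 1 / 10 := by
  unfold delta
  gcongr
  linarith [(Nat.cast_nonneg j : (0 : ℝ) ≤ j)]

theorem lam_pos (j : ℕ) : 0 < lam j := by unfold lam; positivity

theorem one_le_lam (j : ℕ) : 1 ≤ lam j := by
  unfold lam; linarith [(Nat.cast_nonneg j : (0 : ℝ) ≤ j)]

theorem scale_nonneg (j k : ℕ) : 0 ≤ scale j k := Real.sqrt_nonneg _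

theorem horizon_pos (j k : ℕ) : 0 < horizon j k := Real.exp_pos _

theorem scale_sq (j k : ℕ) : scale j k ^ 2 * horizon j k = Real.log k := by
  have hp := horizon_pos j k
  rw [scale, Real.sq_sqrt (div_nonneg (Real.log_natCast_nonneg k) hp.le),
    div_mul_cancel₀ _ hp.ne']

theorem kappa_nonneg (j k : ℕ) : 0 ≤ kappa j k := by
  have := delta_le j
  have := scale_nonneg j k
  unfold kappa
  have : 0 ≤ 1 - delta j := by linarith
  positivity

/-- Keeps all exponents $\kappa$, $\kappa(1\pm\delta)$ in the range required by `mul_b_le_two`. -/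
theorem kappa_mul_one_add_le (j k : ℕ) {r : ℝ} (hr : r ≤ 1 + delta j) :
    kappa j k * r ≤ 2 * scale j k := by
  have h1 := delta_le j
  have h2 := delta_pos j
  have h3 := scale_nonneg j k
  have h4 : √2 ≤ 2 := by rw [Real.sqrt_le_left (by norm_num)]; norm_num
  calc kappa j k * r ≤ kappa j k * (1 + delta j) := by
        gcongr; exact kappa_nonneg j k
    _ = (1 - delta j ^ 2) * (√2 * scale j k) := by unfold kappa; ring
    _ ≤ 1 * (2 * scale j k) := by
        gcongr
        nlinarith
    _ = _ := one_mul _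

theorem A_nonneg {h : ℝ → ℝ} {f : ℕ → ForecasterMove} (hf : ∀ i, (f i).IsLegal h) (n : ℕ) :
    0 ≤ A f n := Finset.sum_nonneg fun i _ => (hf i).1

theorem A_mono {h : ℝ → ℝ} {f : ℕ → ForecasterMove} (hf : ∀ i, (f i).IsLegal h) :
    Monotone (A f) := by
  refine monotone_nat_of_le_succ fun n => ?_
  simp only [A, Finset.sum_range_succ]
  linarith [(hf n).1]

section Stage

variable {h : ℝ → ℝ} {f : ℕ → ForecasterMove} {j i k : ℕ}

theorem log_A_lt (hk : stage j f i = k) : Real.log (A f (i + 1)) < lam j * (k + 1) := by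
  have := Nat.lt_floor_add_one (Real.log (A f (i + 1)) / lam j)
  rw [show ⌊Real.log (A f (i + 1)) / lam j⌋₊ = k from hk, div_lt_iff₀ (lam_pos j)] at this
  linarith

theorem lt_horizon (hf : ∀ i, (f i).IsLegal h) (hk : stage j f i = k) :
    A f (i + 1) < horizon j k := by
  rcases (A_nonneg hf (i + 1)).eq_or_lt with h0 | h0
  · rw [← h0]; exact horizon_pos _ _
  · exact (Real.log_lt_iff_lt_exp h0).1 (log_A_lt hk)

theorem le_log_A (hk : stage j f i = k) (hk1 : 1 ≤ k) : lam j * k ≤ Real.log (A f (i + 1)) := by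
  have hne : stage j f i ≠ 0 := by omega
  have h1 : k ≤ Real.log (A f (i + 1)) / lam j := by
    rw [← hk]; exact Nat.floor_le (le_of_lt (Nat.pos_of_floor_pos (Nat.pos_of_ne_zero hne)))
  rw [le_div_iff₀ (lam_pos j)] at h1
  linarith

theorem A_pos_of_stage (hf : ∀ i, (f i).IsLegal h) (hk : stage j f i = k) (hk1 : 1 ≤ k) :
    0 < A f (i + 1) := by
  refine lt_of_le_of_ne (A_nonneg hf _) fun h0 => ?_
  have h1 := le_log_A hk hk1
  -- The convention `Real.log 0 = 0` puts rounds with `A = 0` in stage 0.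
  rw [← h0, Real.log_zero] at h1
  have : (0 : ℝ) < k := by exact_mod_cast hk1
  nlinarith [mul_pos (lam_pos j) this]

theorem exp_le_A (hf : ∀ i, (f i).IsLegal h) (hk : stage j f i = k) (hk1 : 1 ≤ k) :
    Real.exp (lam j * k) ≤ A f (i + 1) :=
  (Real.le_log_iff_exp_le (A_pos_of_stage hf hk hk1)).1 (le_log_A hk hk1)

theorem log_le_log_log_A (hk : stage j f i = k) (hk2 : 2 ≤ k) :
    Real.log k ≤ Real.log (Real.log (A f (i + 1))) := by
  have h0 : (0 : ℝ) < k := by exact_mod_cast (by omega : 0 < k)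
  have := le_log_A hk (by omega)
  apply Real.log_le_log h0
  nlinarith [one_le_lam j]

theorem log_natCast_pos (hk2 : 2 ≤ k) : 0 < Real.log k :=
  Real.log_pos (by exact_mod_cast (by omega : 1 < k))

theorem b_pos_of_stage (hf : ∀ i, (f i).IsLegal h) (hk : stage j f i = k) (hk2 : 2 ≤ k) :
    0 < b f (i + 1) :=
  Real.sqrt_pos.2 (div_pos (A_pos_of_stage hf hk (by omega))
    ((log_natCast_pos hk2).trans_le (log_le_log_log_A hk hk2)))

/-- Within stage $k$ one has $A<T$ and $\ln k\le\ln\ln A$, so $\frac{\ln k}{T}\cdot\frac{A}{\ln\ln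
A}\le1$. -/
theorem mul_b_le_two (hf : ∀ i, (f i).IsLegal h) (hk : stage j f i = k) (hk2 : 2 ≤ k) {θ : ℝ}
    (hθ : |θ| ≤ 2 * scale j k) : |θ| * b f (i + 1) ≤ 2 := by
  have hL := log_natCast_pos hk2
  have hLL := log_le_log_log_A hk hk2
  have hA := A_pos_of_stage hf hk (by omega)
  have h1 : scale j k * b f (i + 1) ≤ 1 := by
    rw [scale, b, ← Real.sqrt_mul (div_nonneg hL.le (horizon_pos j k).le), Real.sqrt_le_iff, one_pow]
    refine ⟨zero_le_one, ?_⟩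
    rw [div_mul_div_comm, div_le_one (mul_pos (horizon_pos j k) (hL.trans_le hLL))]
    exact (mul_le_mul hLL (lt_horizon hf hk).le hA.le (hL.le.trans hLL)).trans_eq (mul_comm _ _)
  have hb := (b_pos_of_stage hf hk hk2).le
  calc |θ| * b f (i + 1) ≤ 2 * scale j k * b f (i + 1) := by gcongr
    _ ≤ 2 := by linarith

end Stage

/-! ### Multiplicative betting within a stage. -/

/-- Round `i` belongs to stage `k` and Skeptic, in the strategy with number `j`, still bets in it. -/
def Active (h : ℝ → ℝ) (f : ℕ → ForecasterMove) (x : ℕ → ℝ) (j k i : ℕ) : Prop :=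
  -- `2 ≤ k` makes $\ln k$ and hence `b` positive; `j ≤ i` lets infinitely many strategies be mixed
  -- by finite sums. The price budget includes round `i` itself, whose price is known before the
  -- bet.
  stage j f i = k ∧ 2 ≤ k ∧ j ≤ i ∧
    (∀ l < i, stage j f l = k → 0 < fac h f x (kappa j k) (-40) l) ∧
    ∑ l ∈ Finset.range (i + 1) with stage j f l = k, rho h f l ≤ 1 / 100000

open Classical in
/-- The rounds of stage `k` before round `n` in which Skeptic bets. -/
noncomputable def activeSet (h : ℝ → ℝ) (f : ℕ → ForecasterMove) (x : ℕ → ℝ) (j k n : ℕ) :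
    Finset ℕ := {i ∈ Finset.range n | Active h f x j k i}

/-- The capital gained by multiplicative betting in stage `k` up to round `n`. -/
noncomputable def prodFac (h : ℝ → ℝ) (f : ℕ → ForecasterMove) (x : ℕ → ℝ) (j : ℕ) (θ c : ℝ)
    (k n : ℕ) : ℝ := ∏ i ∈ activeSet h f x j k n, fac h f x θ c i

section

variable {h : ℝ → ℝ} {f : ℕ → ForecasterMove} {x : ℕ → ℝ} {j k i n : ℕ} {θ c : ℝ}

theorem mem_activeSet : i ∈ activeSet h f x j k n ↔ i < n ∧ Active h f x j k i := by
  simp [activeSet]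

theorem activeSet_succ_of_active (ha : Active h f x j k n) :
    activeSet h f x j k (n + 1) = insert n (activeSet h f x j k n) := by
  ext i
  simp only [mem_activeSet, Finset.mem_insert]
  constructor
  · rintro ⟨h1, h2⟩
    rcases Nat.lt_succ_iff_lt_or_eq.1 h1 with h3 | h3
    · exact Or.inr ⟨h3, h2⟩
    · exact Or.inl h3
  · rintro (rfl | ⟨h1, h2⟩)
    · exact ⟨Nat.lt_succ_self _, ha⟩
    · exact ⟨by omega, h2⟩

theorem activeSet_succ_of_not_active (ha : ¬ Active h f x j k n) :
    activeSet h f x j k (n + 1) = activeSet h f x j k n := by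
  ext i
  simp only [mem_activeSet]
  constructor
  · rintro ⟨h1, h2⟩
    rcases Nat.lt_succ_iff_lt_or_eq.1 h1 with h3 | h3
    · exact ⟨h3, h2⟩
    · exact absurd (h3 ▸ h2) ha
  · rintro ⟨h1, h2⟩
    exact ⟨by omega, h2⟩

theorem prodFac_succ_of_active (ha : Active h f x j k n) :
    prodFac h f x j θ c k (n + 1) = prodFac h f x j θ c k n * fac h f x θ c n := by
  rw [prodFac, activeSet_succ_of_active ha, Finset.prod_insert (by simp [mem_activeSet]),
    mul_comm, prodFac]

theorem prodFac_succ_of_not_active (ha : ¬ Active h f x j k n) :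
    prodFac h f x j θ c k (n + 1) = prodFac h f x j θ c k n := by
  rw [prodFac, activeSet_succ_of_not_active ha, prodFac]

theorem prodFac_eq_one (hn : ∀ i < n, stage j f i ≠ k) : prodFac h f x j θ c k n = 1 := by
  apply Finset.prod_eq_one
  intro i hi
  rw [mem_activeSet] at hi
  exact absurd hi.2.1 (hn i hi.1)

variable (hh : IsExtraHedge h) (hf : ∀ i, (f i).IsLegal h)
include hh hf

theorem Active.rho_le (ha : Active h f x j k i) : rho h f i ≤ 1 / 100000 :=
  (Finset.single_le_sum (f := rho h f) (fun l _ => rho_nonneg hh (hf l))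
    (Finset.mem_filter.2 ⟨Finset.mem_range.2 (Nat.lt_succ_self i), ha.1⟩)).trans ha.2.2.2.2

theorem sum_rho_activeSet_le : ∑ i ∈ activeSet h f x j k n, rho h f i ≤ 1 / 100000 := by
  rcases (activeSet h f x j k n).eq_empty_or_nonempty with h0 | h0
  -- Otherwise the budget condition at the last active round covers all the active ones.
  · rw [h0]; norm_num
  have hm := (mem_activeSet.1 ((activeSet h f x j k n).max'_mem h0)).2
  refine le_trans (Finset.sum_le_sum_of_subset_of_nonneg ?_ fun l _ _ => rho_nonneg hh (hf l))
    hm.2.2.2.2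
  intro i hi
  rw [Finset.mem_filter, Finset.mem_range]
  exact ⟨Nat.lt_succ_of_le (Finset.le_max' _ i hi), (mem_activeSet.1 hi).2.1⟩

omit hh in
theorem sum_v_activeSet_le : ∑ i ∈ activeSet h f x j k n, (f i).v ≤ horizon j k := by
  rcases (activeSet h f x j k n).eq_empty_or_nonempty with h0 | h0
  · rw [h0]; simpa using (horizon_pos j k).le
  have hm := (mem_activeSet.1 ((activeSet h f x j k n).max'_mem h0)).2
  refine le_trans (Finset.sum_le_sum_of_subset_of_nonneg ?_ fun l _ _ => (hf l).1)
    (lt_horizon hf hm.1).le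
  intro i hi
  rw [Finset.mem_range]
  exact Nat.lt_succ_of_le (Finset.le_max' _ i hi)

theorem exp_le_prodFac (hθ : |θ| ≤ 2 * scale j k)
    (hpos : ∀ i ∈ activeSet h f x j k n, |dev f x i| ≤ b f (i + 1) / 2) :
    Real.exp (θ * ∑ i ∈ activeSet h f x j k n, dev f x i
      - θ ^ 2 / 2 * ∑ i ∈ activeSet h f x j k n, (f i).v - 1 / 100) ≤ prodFac h f x j θ 40 k n := by
  have h1 : Real.exp (∑ i ∈ activeSet h f x j k n,
      (θ * dev f x i - θ ^ 2 / 2 * (f i).v - 400 * rho h f i)) ≤ prodFac h f x j θ 40 k n := by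
    rw [Real.exp_sum]
    refine Finset.prod_le_prod (fun _ _ => (Real.exp_pos _).le) fun i hi => ?_
    have ha := (mem_activeSet.1 hi).2
    exact exp_le_fac hh (hf i) (b_pos_of_stage hf ha.1 ha.2.1) (mul_b_le_two hf ha.1 ha.2.1 hθ)
      (ha.rho_le hh hf) (hpos i hi)
  refine le_trans (Real.exp_le_exp.2 ?_) h1
  rw [Finset.sum_sub_distrib, Finset.sum_sub_distrib, ← Finset.mul_sum, ← Finset.mul_sum,
    ← Finset.mul_sum]
  -- The price budget bounds the accumulated error by $400/100000\le1/100$.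
  linarith [sum_rho_activeSet_le hh hf (x := x) (j := j) (k := k) (n := n)]

theorem prodFac_nonneg (hθ : |θ| ≤ 2 * scale j k) : 0 ≤ prodFac h f x j θ 40 k n := by
  refine Finset.prod_nonneg fun i hi => ?_
  have ha := (mem_activeSet.1 hi).2
  exact fac_nonneg hh (hf i) (b_pos_of_stage hf ha.1 ha.2.1) (mul_b_le_two hf ha.1 ha.2.1 hθ)
    (ha.rho_le hh hf)

omit hh hf in
theorem abs_kappa_mul_le {r : ℝ} (hr0 : 0 ≤ r) (hr : r ≤ 1 + delta j) :
    |kappa j k * r| ≤ 2 * scale j k := by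
  rw [abs_of_nonneg (mul_nonneg (kappa_nonneg j k) hr0)]
  exact kappa_mul_one_add_le j k hr

omit hh hf in
theorem abs_kappa_le : |kappa j k| ≤ 2 * scale j k := by
  rw [abs_of_nonneg (kappa_nonneg j k)]
  simpa using kappa_mul_one_add_le j k (r := 1) (by linarith [delta_pos j])

theorem abs_dev_le_of_mem_activeSet
    (hpos : ∀ i ∈ activeSet h f x j k n, 0 < fac h f x (kappa j k) (-40) i) :
    ∀ i ∈ activeSet h f x j k n, |dev f x i| ≤ b f (i + 1) / 2 := by
  intro i hi
  have ha := (mem_activeSet.1 hi).2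
  exact abs_dev_le_of_fac_pos hh (hf i) (b_pos_of_stage hf ha.1 ha.2.1)
    (mul_b_le_two hf ha.1 ha.2.1 abs_kappa_le) (ha.rho_le hh hf) (hpos i hi)

theorem prodFac_le_exp
    (hpos : ∀ i ∈ activeSet h f x j k n, 0 < fac h f x (kappa j k) (-40) i) :
    prodFac h f x j (kappa j k) (-40) k n ≤
      Real.exp (kappa j k * ∑ i ∈ activeSet h f x j k n, dev f x i
      - kappa j k ^ 2 / 2 * ∑ i ∈ activeSet h f x j k n, (f i).v + 1 / 100) := by
  have h1 : prodFac h f x j (kappa j k) (-40) k n ≤ Real.exp (∑ i ∈ activeSet h f x j k n,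
      (kappa j k * dev f x i - kappa j k ^ 2 / 2 * (f i).v + 400 * rho h f i)) := by
    rw [Real.exp_sum]
    refine Finset.prod_le_prod (fun i hi => (hpos i hi).le) fun i hi => ?_
    have ha := (mem_activeSet.1 hi).2
    exact fac_le_exp hh (hf i) (b_pos_of_stage hf ha.1 ha.2.1)
      (mul_b_le_two hf ha.1 ha.2.1 abs_kappa_le)
      (ha.rho_le hh hf) (abs_dev_le_of_mem_activeSet hh hf hpos i hi)
  refine h1.trans (Real.exp_le_exp.2 ?_)
  rw [Finset.sum_add_distrib, Finset.sum_sub_distrib, ← Finset.mul_sum, ← Finset.mul_sum,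
    ← Finset.mul_sum]
  linarith [sum_rho_activeSet_le hh hf (x := x) (j := j) (k := k) (n := n)]

omit hh hf in
/-- Skeptic stops betting in a stage as soon as the main factor fails to be positive. -/
theorem fac_pos_or_prodFac_nonpos :
    (∀ i ∈ activeSet h f x j k n, 0 < fac h f x (kappa j k) (-40) i) ∨
      prodFac h f x j (kappa j k) (-40) k n ≤ 0 := by
  by_contra! hcon
  obtain ⟨⟨i, hi, hle⟩, hpos⟩ := hcon
  have hi' := (mem_activeSet.1 hi).2
  rw [prodFac, ← Finset.mul_prod_erase _ _ hi] at hpos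
  -- The round with the nonpositive factor is the last active one: betting past an earlier round
  -- requires that round's factor to be positive.
  have : 0 ≤ ∏ l ∈ (activeSet h f x j k n).erase i, fac h f x (kappa j k) (-40) l := by
    refine Finset.prod_nonneg fun l hl => ?_
    obtain ⟨hne, hl⟩ := Finset.mem_erase.1 hl
    have hl' := (mem_activeSet.1 hl).2
    rcases lt_or_gt_of_ne hne with hlt | hgt
    · exact (hi'.2.2.2.1 l hlt hl'.1).le
    · exact absurd (hl'.2.2.2.1 i hgt hi'.1) (not_lt.2 hle)
  nlinarith

end

/-! ### The combination of products that bets against a large increment. -/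

/-- The bet of stage `k` against a large increment in that stage; see `phi`. -/
noncomputable def peak (h : ℝ → ℝ) (f : ℕ → ForecasterMove) (x : ℕ → ℝ) (j k n : ℕ) : ℝ :=
  prodFac h f x j (kappa j k) (-40) k n
    - prodFac h f x j (kappa j k * (1 + delta j)) 40 k n / 3
    - prodFac h f x j (kappa j k * (1 - delta j)) 40 k n / 3

/-- An upper bound for `peak`. -/
noncomputable def peakBound (j k : ℕ) : ℝ := Real.exp (2 / delta j + 1) * k

/-- The capital in stage `k` relative to the capital before that stage. -/
noncomputable def phi (h : ℝ → ℝ) (f : ℕ → ForecasterMove) (x : ℕ → ℝ) (j k n : ℕ) : ℝ :=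
  1 + (1 / 3 - peak h f x j k n) / (2 * peakBound j k)

section

variable {h : ℝ → ℝ} {f : ℕ → ForecasterMove} {x : ℕ → ℝ} {j k i n : ℕ} {θ c : ℝ}

theorem one_le_peakBound (hk : 1 ≤ k) : 1 ≤ peakBound j k := by
  have h1 : (1 : ℝ) ≤ k := by exact_mod_cast hk
  have h2 : 1 ≤ Real.exp (2 / delta j + 1) := Real.one_le_exp (by have := delta_pos j; positivity)
  unfold peakBound
  nlinarith

theorem phi_eq_one (hn : ∀ i < n, stage j f i ≠ k) : phi h f x j k n = 1 := by
  rw [phi, peak, prodFac_eq_one hn, prodFac_eq_one hn, prodFac_eq_one hn]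
  norm_num

theorem log_three_le : Real.log 3 ≤ 3 / 2 := by
  rw [Real.log_le_iff_le_exp (by norm_num)]
  have := Real.quadratic_le_exp_of_nonneg (show (0 : ℝ) ≤ 3 / 2 by norm_num)
  linarith

/-- A positive `peak` means that the main product exceeds a third of the product for
$\kappa(1+\delta)$, which bounds $\kappa s$ by $\kappa^2(1+\delta/2)a+O(1/\delta)$. The exponent
$\kappa s-\kappa^2a/2$ is then at most $\kappa^2(1+\delta)a/2+O(1/\delta)\le\ln k+O(1/\delta)$,
because $(1+\delta)(1-\delta)^2\le1$. -/
theorem peak_le (hh : IsExtraHedge h) (hf : ∀ i, (f i).IsLegal h) (hk : 1 ≤ k) :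
    peak h f x j k n ≤ peakBound j k := by
  have hd := delta_pos j
  have hd1 := delta_le j
  have hM := one_le_peakBound (j := j) hk
  have h2 : 0 ≤ prodFac h f x j (kappa j k * (1 + delta j)) 40 k n :=
    prodFac_nonneg hh hf (abs_kappa_mul_le (by linarith) le_rfl)
  have h3 : 0 ≤ prodFac h f x j (kappa j k * (1 - delta j)) 40 k n :=
    prodFac_nonneg hh hf (abs_kappa_mul_le (by linarith) (by linarith))
  rcases fac_pos_or_prodFac_nonpos (h := h) (f := f) (x := x) (j := j) (k := k) (n := n)
    with hpos | hle
  swap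
  · unfold peak; linarith
  by_contra! hcon
  have hE1 := prodFac_le_exp hh hf hpos
  have hE2 := exp_le_prodFac hh hf (abs_kappa_mul_le (k := k) (by linarith) le_rfl)
    (abs_dev_le_of_mem_activeSet hh hf hpos)
  have ha := sum_v_activeSet_le hf (h := h) (x := x) (j := j) (k := k) (n := n)
  set s := ∑ i ∈ activeSet h f x j k n, dev f x i
  set a := ∑ i ∈ activeSet h f x j k n, (f i).v
  set κ := kappa j k with hκ
  set d := delta j
  unfold peak at hcon
  have hlt : Real.exp (κ * (1 + d) * s - (κ * (1 + d)) ^ 2 / 2 * a - 1 / 100) / 3 <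
      Real.exp (κ * s - κ ^ 2 / 2 * a + 1 / 100) := by linarith
  have hlt2 : Real.exp (κ * (1 + d) * s - (κ * (1 + d)) ^ 2 / 2 * a - 1 / 100) <
      Real.exp (κ * s - κ ^ 2 / 2 * a + 1 / 100 + 3 / 2) := by
    rw [Real.exp_add _ (3 / 2)]
    have : 3 ≤ Real.exp (3 / 2) := by
      rw [← Real.log_le_iff_le_exp (by norm_num)]; exact log_three_le
    have := Real.exp_pos (κ * s - κ ^ 2 / 2 * a + 1 / 100)
    nlinarith
  rw [Real.exp_lt_exp] at hlt2
  have hks : κ * s < κ ^ 2 * (1 + d / 2) * a + (3 / 2 + 1 / 50) / d := by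
    have : d * (κ * s) < d * (κ ^ 2 * (1 + d / 2) * a + (3 / 2 + 1 / 50) / d) := by
      rw [mul_add, mul_div_cancel₀ _ hd.ne']
      nlinarith
    exact lt_of_mul_lt_mul_left this hd.le
  have hk0 : (0 : ℝ) < k := by exact_mod_cast hk
  have hκT : κ ^ 2 * horizon j k = (1 - d) ^ 2 * 2 * Real.log k := by
    have h22 : √2 ^ 2 = (2 : ℝ) := Real.sq_sqrt (by norm_num)
    rw [hκ, kappa, ← scale_sq j k]
    linear_combination (1 - d) ^ 2 * scale j k ^ 2 * horizon j k * h22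
  have hκa : κ ^ 2 * (1 + d) * a / 2 ≤ Real.log k := by
    have hL := Real.log_natCast_nonneg k
    have : κ ^ 2 * (1 + d) * a ≤ κ ^ 2 * (1 + d) * horizon j k := by gcongr
    have h5 : κ ^ 2 * (1 + d) * horizon j k = (1 + d) * ((1 - d) ^ 2 * 2 * Real.log k) := by
      rw [← hκT]; ring
    have h6 : (1 + d) * (1 - d) ^ 2 ≤ 1 := by
      have : 0 ≤ d * (1 + d - d ^ 2) := mul_nonneg hd.le (by nlinarith)
      linarith
    nlinarith [mul_le_mul_of_nonneg_right h6 hL]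
  have hexp : κ * s - κ ^ 2 / 2 * a + 1 / 100 ≤ 2 / d + 1 + Real.log k := by
    have : (3 / 2 + 1 / 50) / d ≤ 2 / d := by gcongr; norm_num
    nlinarith
  have hfin : Real.exp (κ * s - κ ^ 2 / 2 * a + 1 / 100) ≤ peakBound j k := by
    refine (Real.exp_le_exp.2 hexp).trans_eq ?_
    rw [Real.exp_add, Real.exp_log hk0, peakBound]
  linarith

theorem half_le_phi_of_one_le (hh : IsExtraHedge h) (hf : ∀ i, (f i).IsLegal h) (hk : 1 ≤ k) :
    1 / 2 ≤ phi h f x j k n := by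
  have h1 := peak_le hh hf hk (x := x) (j := j) (n := n)
  have h2 := one_le_peakBound (j := j) hk
  have : -(1 / 2) ≤ (1 / 3 - peak h f x j k n) / (2 * peakBound j k) := by
    rw [le_div_iff₀ (by linarith)]; linarith
  unfold phi
  linarith

theorem one_add_le_phi (hk : 1 ≤ k) (hp : peak h f x j k n ≤ 0) :
    1 + 1 / (6 * peakBound j k) ≤ phi h f x j k n := by
  have h2 := one_le_peakBound (j := j) hk
  have : 1 / (6 * peakBound j k) = (1 / 3) / (2 * peakBound j k) := by field_simp; norm_num
  rw [phi, this]
  gcongr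
  linarith

/-- `peak` is nonpositive if the sum of the deviations in the stage is moderate. -/
theorem peak_nonpos (hh : IsExtraHedge h) (hf : ∀ i, (f i).IsLegal h)
    (ha : (1 - delta j) * horizon j k ≤ ∑ i ∈ activeSet h f x j k n, (f i).v)
    (hL : 2 ≤ delta j ^ 2 * Real.log k)
    (hs : ∑ i ∈ activeSet h f x j k n, dev f x i ≤
      (1 - 5 * delta j) * (√2 * scale j k * horizon j k)) :
    peak h f x j k n ≤ 0 := by
  have hd := delta_pos j
  have hd1 := delta_le j
  have h2 : 0 ≤ prodFac h f x j (kappa j k * (1 + delta j)) 40 k n :=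
    prodFac_nonneg hh hf (abs_kappa_mul_le (by linarith) le_rfl)
  have h3 : 0 ≤ prodFac h f x j (kappa j k * (1 - delta j)) 40 k n :=
    prodFac_nonneg hh hf (abs_kappa_mul_le (by linarith) (by linarith))
  rcases fac_pos_or_prodFac_nonpos (h := h) (f := f) (x := x) (j := j) (k := k) (n := n)
    with hpos | hle
  swap
  · unfold peak; linarith
  have hE1 := prodFac_le_exp hh hf hpos
  have hE2 := exp_le_prodFac hh hf (abs_kappa_mul_le (r := 1 - delta j) (k := k) (by linarith)
    (by linarith)) (abs_dev_le_of_mem_activeSet hh hf hpos)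
  set s := ∑ i ∈ activeSet h f x j k n, dev f x i
  set a := ∑ i ∈ activeSet h f x j k n, (f i).v
  set κ := kappa j k with hκ
  set d := delta j
  have h22 : √2 ^ 2 = (2 : ℝ) := Real.sq_sqrt (by norm_num)
  have hκT : κ ^ 2 * horizon j k = (1 - d) ^ 2 * 2 * Real.log k := by
    rw [hκ, kappa, ← scale_sq j k]
    linear_combination (1 - d) ^ 2 * scale j k ^ 2 * horizon j k * h22
  have hκs : κ * s ≤ (1 - 5 * d) * (1 - d) * 2 * Real.log k := by
    calc κ * s ≤ κ * ((1 - 5 * d) * (√2 * scale j k * horizon j k)) := by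
          gcongr; exact kappa_nonneg j k
      _ = (1 - 5 * d) * (1 - d) * 2 * Real.log k := by
          rw [hκ, kappa, ← scale_sq j k]
          linear_combination (1 - 5 * d) * (1 - d) * scale j k ^ 2 * horizon j k * h22
  have hκa : (1 - d) ^ 3 * 2 * Real.log k ≤ κ ^ 2 * a := by
    calc (1 - d) ^ 3 * 2 * Real.log k = κ ^ 2 * ((1 - d) * horizon j k) := by
          linear_combination -(1 - d) * hκT
      _ ≤ κ ^ 2 * a := by gcongr
  -- This inequality makes the product for $\kappa(1-\delta)$ at least three times the main one. The
  -- loss $5\delta$ in the threshold leaves a margin $5\delta+O(\delta^2)$ in `e3`, and `hL` turns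
  -- it into the additive 2.
  have hkey : d * (κ * s) + 2 ≤ κ ^ 2 * a * (d * (1 - d / 2)) := by
    have hL0 := Real.log_natCast_nonneg k
    have e1 : (1 - d) ^ 3 * 2 * Real.log k * (d * (1 - d / 2)) ≤ κ ^ 2 * a * (d * (1 - d / 2)) := by
      gcongr
      nlinarith
    have e2 : d * (κ * s) ≤ d * ((1 - 5 * d) * (1 - d) * 2 * Real.log k) := by gcongr
    have e3 : d ≤ (1 - d) ^ 3 * 2 * (1 - d / 2) - (1 - 5 * d) * (1 - d) * 2 := by nlinarith
    have e4 : d * (d * Real.log k) ≤ ((1 - d) ^ 3 * 2 * (1 - d / 2) - (1 - 5 * d) * (1 - d) * 2)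
        * (d * Real.log k) := by gcongr
    nlinarith
  have hexp : κ * s - κ ^ 2 / 2 * a + 1 / 100 + 3 / 2 ≤
      κ * (1 - d) * s - (κ * (1 - d)) ^ 2 / 2 * a - 1 / 100 := by nlinarith
  have h4 : 3 * Real.exp (κ * s - κ ^ 2 / 2 * a + 1 / 100) ≤
      Real.exp (κ * (1 - d) * s - (κ * (1 - d)) ^ 2 / 2 * a - 1 / 100) := by
    refine le_trans ?_ (Real.exp_le_exp.2 hexp)
    rw [Real.exp_add _ (3 / 2)]
    have : 3 ≤ Real.exp (3 / 2) := by
      rw [← Real.log_le_iff_le_exp (by norm_num)]; exact log_three_le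
    have := Real.exp_pos (κ * s - κ ^ 2 / 2 * a + 1 / 100)
    nlinarith
  unfold peak
  linarith

end

/-! ### Averaging and mixing strategies. -/

instance : Zero SkepticMove := ⟨⟨0, 0, 0⟩⟩

instance : Add SkepticMove := ⟨fun s t => ⟨s.M + t.M, s.V + t.V, s.W + t.W⟩⟩

noncomputable instance : SMul ℝ SkepticMove := ⟨fun c s => ⟨c * s.M, c * s.V, c * s.W⟩⟩

theorem gain_zero (h : ℝ → ℝ) (f : ForecasterMove) (x : ℝ) : gain h f 0 x = 0 := by
  change (0 : ℝ) * _ + 0 * _ + 0 * _ = 0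
  ring

theorem gain_add (h : ℝ → ℝ) (f : ForecasterMove) (s t : SkepticMove) (x : ℝ) :
    gain h f (s + t) x = gain h f s x + gain h f t x := by
  change (s.M + t.M) * _ + (s.V + t.V) * _ + (s.W + t.W) * _ = _
  unfold gain
  ring

theorem gain_smul (h : ℝ → ℝ) (f : ForecasterMove) (c : ℝ) (s : SkepticMove) (x : ℝ) :
    gain h f (c • s) x = c * gain h f s x := by
  change (c * s.M) * _ + (c * s.V) * _ + (c * s.W) * _ = _
  unfold gain
  ring

/-- Skeptic can force the event `E` by a strategy that does not bet before round `j`. -/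
def CanForceFrom (h : ℝ → ℝ) (j : ℕ) (E : (ℕ → ForecasterMove) → (ℕ → ℝ) → Prop) : Prop :=
  ∃ σ : SkepticStrategy, (∀ f x, ∀ n < j, σ.move f x n = 0) ∧
    ∀ (f : ℕ → ForecasterMove) (x : ℕ → ℝ), (∀ n, (f n).IsLegal h) →
      (∀ n, 0 ≤ capital h σ f x n) ∧ (E f x ∨ Tendsto (capital h σ f x) atTop atTop)

theorem CanForceFrom.and {h : ℝ → ℝ} {j : ℕ} {E E' : (ℕ → ForecasterMove) → (ℕ → ℝ) → Prop}
    (hE : CanForceFrom h j E) (hE' : CanForceFrom h j E') :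
    CanForceFrom h j fun f x => E f x ∧ E' f x := by
  obtain ⟨σ, h0, hσ⟩ := hE
  obtain ⟨τ, h0', hτ⟩ := hE'
  let ν : SkepticStrategy :=
    { move := fun f x n => (1 / 2 : ℝ) • (σ.move f x n + τ.move f x n)
      nonanticipating := fun f f' x x' n hf hx => by
        rw [σ.nonanticipating f f' x x' n hf hx, τ.nonanticipating f f' x x' n hf hx] }
  have hcap : ∀ f x n, capital h ν f x n = (capital h σ f x n + capital h τ f x n) / 2 := by
    intro f x n
    induction n with
    | zero => norm_num [capital]
    | succ n ih =>
      simp only [capital, ih]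
      rw [show ν.move f x n = (1 / 2 : ℝ) • (σ.move f x n + τ.move f x n) from rfl, gain_smul,
        gain_add]
      ring
  refine ⟨ν, fun f x n hn => ?_, fun f x hf => ?_⟩
  · change (1 / 2 : ℝ) • (σ.move f x n + τ.move f x n) = 0
    rw [h0 f x n hn, h0' f x n hn]
    change (⟨1 / 2 * (0 + 0), 1 / 2 * (0 + 0), 1 / 2 * (0 + 0)⟩ : SkepticMove) = ⟨0, 0, 0⟩
    norm_num
  obtain ⟨hp, hor⟩ := hσ f x hf
  obtain ⟨hp', hor'⟩ := hτ f x hf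
  refine ⟨fun n => by rw [hcap]; linarith [hp n, hp' n], ?_⟩
  rcases hor with hEf | ht
  · rcases hor' with hEf' | ht
    · exact Or.inl ⟨hEf, hEf'⟩
    · refine Or.inr (tendsto_atTop_mono (fun n => ?_) (ht.atTop_div_const two_pos))
      rw [hcap]; linarith [hp n]
  · refine Or.inr (tendsto_atTop_mono (fun n => ?_) (ht.atTop_div_const two_pos))
    rw [hcap]; linarith [hp' n]

theorem gain_sum (h : ℝ → ℝ) (f : ForecasterMove) (x : ℝ) (w : ℕ → ℝ) (s : ℕ → SkepticMove)
    (t : Finset ℕ) :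
    gain h f ⟨∑ j ∈ t, w j * (s j).M, ∑ j ∈ t, w j * (s j).V, ∑ j ∈ t, w j * (s j).W⟩ x =
      ∑ j ∈ t, w j * gain h f (s j) x := by
  simp only [gain, Finset.sum_mul, ← Finset.sum_add_distrib]
  exact Finset.sum_congr rfl fun j _ => by ring

theorem sum_half_pow (n : ℕ) : ∑ j ∈ Finset.range n, (1 / 2 : ℝ) ^ (j + 1) = 1 - (1 / 2) ^ n := by
  induction n with
  | zero => simp
  | succ n ih => rw [Finset.sum_range_succ, ih]; ring

/-- Mix with weights $2^{-(j+1)}$. Strategy `j` is idle before round `j`, so each mixed move is a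
finite sum; capitals are nonnegative, so divergence of one component is enough. -/
theorem canForce_forall {h : ℝ → ℝ} {E : ℕ → (ℕ → ForecasterMove) → (ℕ → ℝ) → Prop}
    (hE : ∀ j, CanForceFrom h j (E j)) : CanForce h fun f x => ∀ j, E j f x := by
  choose σ h0 hσ using hE
  let ν : SkepticStrategy :=
    { move := fun f x n =>
        ⟨∑ j ∈ Finset.range (n + 1), (1 / 2 : ℝ) ^ (j + 1) * ((σ j).move f x n).M,
          ∑ j ∈ Finset.range (n + 1), (1 / 2 : ℝ) ^ (j + 1) * ((σ j).move f x n).V,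
          ∑ j ∈ Finset.range (n + 1), (1 / 2 : ℝ) ^ (j + 1) * ((σ j).move f x n).W⟩
      nonanticipating := fun f f' x x' n hf hx => by
        simp only [fun j => (σ j).nonanticipating f f' x x' n hf hx] }
  have hone : ∀ f x j n, n ≤ j → capital h (σ j) f x n = 1 := by
    intro f x j n
    induction n with
    | zero => intro _; rfl
    | succ n ih =>
      intro hn
      simp only [capital]
      rw [h0 j f x n hn, gain_zero, ih (by omega), add_zero]
  have hcap : ∀ f x n, capital h ν f x n =
      1 + ∑ j ∈ Finset.range n, (1 / 2 : ℝ) ^ (j + 1) * (capital h (σ j) f x n - 1) := by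
    intro f x n
    induction n with
    | zero => simp [capital]
    | succ n ih =>
      have hg : gain h (f n) (ν.move f x n) (x n) = ∑ j ∈ Finset.range (n + 1),
          (1 / 2 : ℝ) ^ (j + 1) * gain h (f n) ((σ j).move f x n) (x n) :=
        gain_sum h (f n) (x n) _ (fun j => (σ j).move f x n) _
      -- The newly added strategy `n` still has capital 1 and contributes zero.
      have ih' : capital h ν f x n = 1 + ∑ j ∈ Finset.range (n + 1),
          (1 / 2 : ℝ) ^ (j + 1) * (capital h (σ j) f x n - 1) := by
        rw [ih, Finset.sum_range_succ, hone f x n n le_rfl]; simp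
      simp only [capital]
      rw [ih', hg, add_assoc, ← Finset.sum_add_distrib]
      congr 1
      exact Finset.sum_congr rfl fun j _ => by ring
  have hcap' : ∀ f x n, capital h ν f x n = (1 / 2) ^ n +
      ∑ j ∈ Finset.range n, (1 / 2 : ℝ) ^ (j + 1) * capital h (σ j) f x n := by
    intro f x n
    rw [hcap]
    simp only [mul_sub, mul_one, Finset.sum_sub_distrib, sum_half_pow]
    ring
  refine ⟨ν, fun f x hf => ?_⟩
  have hp : ∀ j n, 0 ≤ capital h (σ j) f x n := fun j => (hσ j f x hf).1
  have hp2 : ∀ n, ∀ j ∈ Finset.range n, 0 ≤ (1 / 2 : ℝ) ^ (j + 1) * capital h (σ j) f x n :=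
    fun n j _ => mul_nonneg (by positivity) (hp j n)
  refine ⟨fun n => ?_, ?_⟩
  · rw [hcap']
    exact add_nonneg (by positivity) (Finset.sum_nonneg (hp2 n))
  by_cases hall : ∀ j, E j f x
  · exact Or.inl hall
  obtain ⟨j, hj⟩ := not_forall.1 hall
  have ht := ((hσ j f x hf).2.resolve_left hj).const_mul_atTop
    (show (0 : ℝ) < (1 / 2) ^ (j + 1) by positivity)
  refine Or.inr (tendsto_atTop_mono' _ ?_ ht)
  filter_upwards [eventually_gt_atTop j] with n hn
  rw [hcap']
  have := Finset.single_le_sum (hp2 n) (Finset.mem_range.2 hn)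
  have : (0 : ℝ) ≤ (1 / 2) ^ n := by positivity
  linarith

/-! ### Dependence on past announcements only. -/

section Congr

variable {h : ℝ → ℝ} {f f' : ℕ → ForecasterMove} {x x' : ℕ → ℝ} {j k n : ℕ} {θ c : ℝ}

theorem A_congr (hf : ∀ i < n, f i = f' i) : A f n = A f' n :=
  Finset.sum_congr rfl fun i hi => by rw [hf i (Finset.mem_range.1 hi)]

theorem b_congr (hf : ∀ i ≤ n, f i = f' i) : b f (n + 1) = b f' (n + 1) := by
  rw [b, b, A_congr fun i hi => hf i (Nat.lt_succ_iff.1 hi)]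

theorem stage_congr (hf : ∀ i ≤ n, f i = f' i) : stage j f n = stage j f' n := by
  rw [stage, stage, A_congr fun i hi => hf i (Nat.lt_succ_iff.1 hi)]

theorem rho_congr (hf : ∀ i ≤ n, f i = f' i) : rho h f n = rho h f' n := by
  rw [rho, rho, b_congr hf, hf n le_rfl]

theorem fac_congr (hf : ∀ i ≤ n, f i = f' i) (hx : x n = x' n) :
    fac h f x θ c n = fac h f' x' θ c n := by
  simp only [fac, payoff, dev, rho_congr hf, b_congr hf, hf n le_rfl, hx]

theorem active_congr (hf : ∀ i ≤ n, f i = f' i) (hx : ∀ i < n, x i = x' i) :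
    Active h f x j k n ↔ Active h f' x' j k n := by
  have hs : ∀ i ≤ n, stage j f i = stage j f' i :=
    fun i hi => stage_congr fun l hl => hf l (hl.trans hi)
  have h1 : (∀ l < n, stage j f l = k → 0 < fac h f x (kappa j k) (-40) l) ↔
      ∀ l < n, stage j f' l = k → 0 < fac h f' x' (kappa j k) (-40) l := by
    refine forall₂_congr fun l hl => ?_
    rw [hs l hl.le, fac_congr (fun i hi => hf i (hi.trans hl.le)) (hx l hl)]
  have h2 : ∑ l ∈ Finset.range (n + 1) with stage j f l = k, rho h f l =
      ∑ l ∈ Finset.range (n + 1) with stage j f' l = k, rho h f' l := by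
    rw [Finset.sum_filter, Finset.sum_filter]
    refine Finset.sum_congr rfl fun l hl => ?_
    have hl' := Nat.lt_succ_iff.1 (Finset.mem_range.1 hl)
    rw [hs l hl', rho_congr fun i hi => hf i (hi.trans hl')]
  unfold Active
  rw [h1, h2, hs n le_rfl]

theorem activeSet_congr (hf : ∀ i < n, f i = f' i) (hx : ∀ i < n, x i = x' i) :
    activeSet h f x j k n = activeSet h f' x' j k n := by
  ext i
  rw [mem_activeSet, mem_activeSet]
  refine and_congr_right fun hi => active_congr (fun l hl => hf l (hl.trans_lt hi))
    fun l hl => hx l (hl.trans hi)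

theorem prodFac_congr (hf : ∀ i < n, f i = f' i) (hx : ∀ i < n, x i = x' i) :
    prodFac h f x j θ c k n = prodFac h f' x' j θ c k n := by
  rw [prodFac, prodFac, activeSet_congr hf hx]
  refine Finset.prod_congr rfl fun i hi => ?_
  have hi' := (mem_activeSet.1 hi).1
  exact fac_congr (fun l hl => hf l (hl.trans_lt hi')) (hx i hi')

theorem phi_congr (hf : ∀ i < n, f i = f' i) (hx : ∀ i < n, x i = x' i) :
    phi h f x j k n = phi h f' x' j k n := by
  rw [phi, phi, peak, peak, prodFac_congr hf hx, prodFac_congr hf hx, prodFac_congr hf hx]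

end Congr

/-! ### Moves that realize the products. -/

/-- The move that multiplies a unit stake by `fac`. -/
noncomputable def facMove (h : ℝ → ℝ) (f : ℕ → ForecasterMove) (θ c : ℝ) (n : ℕ) : SkepticMove :=
  ⟨θ, θ ^ 2 / 2, c / h (b f (n + 1))⟩

theorem gain_facMove (h : ℝ → ℝ) (f : ℕ → ForecasterMove) (x : ℕ → ℝ) (θ c : ℝ) (n : ℕ) :
    gain h (f n) (facMove h f θ c n) (x n) = fac h f x θ c n - 1 := by
  simp only [gain, facMove, fac, payoff, rho, dev]
  ring

open Classical in
/-- The move whose gain is the increment of `prodFac`. -/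
noncomputable def prodFacMove (h : ℝ → ℝ) (f : ℕ → ForecasterMove) (x : ℕ → ℝ) (j : ℕ) (θ c : ℝ)
    (k n : ℕ) : SkepticMove :=
  if Active h f x j k n then prodFac h f x j θ c k n • facMove h f θ c n else 0

section

variable {h : ℝ → ℝ} {f f' : ℕ → ForecasterMove} {x x' : ℕ → ℝ} {j k n : ℕ} {θ c : ℝ}

theorem prodFac_succ : prodFac h f x j θ c k (n + 1) =
    prodFac h f x j θ c k n + gain h (f n) (prodFacMove h f x j θ c k n) (x n) := by
  by_cases ha : Active h f x j k n
  · rw [prodFac_succ_of_active ha, prodFacMove, if_pos ha, gain_smul, gain_facMove]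
    ring
  · rw [prodFac_succ_of_not_active ha, prodFacMove, if_neg ha, gain_zero, add_zero]

theorem prodFacMove_congr (hf : ∀ i ≤ n, f i = f' i) (hx : ∀ i < n, x i = x' i) :
    prodFacMove h f x j θ c k n = prodFacMove h f' x' j θ c k n := by
  have ha := active_congr (h := h) (j := j) (k := k) hf hx
  rw [prodFacMove, prodFacMove, facMove, facMove, b_congr hf,
    prodFac_congr (fun i hi => hf i hi.le) hx]
  by_cases h1 : Active h f x j k n
  · rw [if_pos h1, if_pos (ha.1 h1)]
  · rw [if_neg h1, if_neg (mt ha.2 h1)]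

theorem prodFacMove_eq_zero (hn : n < j) : prodFacMove h f x j θ c k n = 0 :=
  if_neg fun ha => absurd ha.2.2.1 (not_le.2 hn)

end

/-! ### Forcing summability of the hedge payoffs. -/

/-- The total normalized price of the extra hedge up to round `n`. -/
noncomputable def totalRho (h : ℝ → ℝ) (f : ℕ → ForecasterMove) (n : ℕ) : ℝ :=
  ∑ i ∈ Finset.range n, rho h f i

/-- Skeptic's strategy that buys the extra hedge in proportions decreasing with its total price. -/
noncomputable def hedgeStrategy (h : ℝ → ℝ) (j : ℕ) : SkepticStrategy where
  move f _ n :=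
    if j ≤ n then ⟨0, 0, 1 / (1 + totalRho h f (n + 1)) ^ 2 / h (b f (n + 1))⟩ else 0
  nonanticipating f f' x x' n hf hx := by
    have : totalRho h f (n + 1) = totalRho h f' (n + 1) :=
      Finset.sum_congr rfl fun i hi =>
        rho_congr fun l hl => hf l (hl.trans (Nat.lt_succ_iff.1 (Finset.mem_range.1 hi)))
    rw [this, b_congr hf]

/-- With $R$ the total price so far, $\rho/(1+R+\rho)^2\le1/(1+R)-1/(1+R+\rho)$, so expenses
telescope and never exceed the initial unit. -/
theorem capital_hedgeStrategy_ge {h : ℝ → ℝ} (hh : IsExtraHedge h) (j : ℕ)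
    {f : ℕ → ForecasterMove} (x : ℕ → ℝ) (hf : ∀ i, (f i).IsLegal h) (n : ℕ) :
    1 / (1 + totalRho h f n) + ∑ i ∈ Finset.range n,
      1 / (1 + totalRho h f (i + 1)) ^ 2 * (if j ≤ i then payoff h f x i else 0) ≤
      capital h (hedgeStrategy h j) f x n := by
  induction n with
  | zero => simp [capital, totalRho]
  | succ n ih =>
    have hR : 0 ≤ totalRho h f n := Finset.sum_nonneg fun i _ => rho_nonneg hh (hf i)
    have hρ := rho_nonneg hh (hf n)
    have hs : totalRho h f (n + 1) = totalRho h f n + rho h f n := Finset.sum_range_succ _ _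
    have hstep : 1 / (1 + totalRho h f (n + 1)) ≤ 1 / (1 + totalRho h f n) -
        1 / (1 + totalRho h f (n + 1)) ^ 2 * rho h f n := by
      rw [hs, ← sub_nonneg]
      have : 1 / (1 + totalRho h f n) - 1 / (1 + (totalRho h f n + rho h f n)) ^ 2 * rho h f n -
          1 / (1 + (totalRho h f n + rho h f n)) = rho h f n ^ 2 /
          ((1 + totalRho h f n) * (1 + (totalRho h f n + rho h f n)) ^ 2) := by
        have h1 : (1 + totalRho h f n) ≠ 0 := by positivity
        have h2 : (1 + (totalRho h f n + rho h f n)) ≠ 0 := by positivity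
        field_simp
        ring
      rw [this]
      positivity
    rw [Finset.sum_range_succ, capital]
    by_cases hj : j ≤ n
    · have hg : gain h (f n) ((hedgeStrategy h j).move f x n) (x n) =
          1 / (1 + totalRho h f (n + 1)) ^ 2 * (payoff h f x n - rho h f n) := by
        simp only [hedgeStrategy, if_pos hj, gain, payoff, rho, dev]
        ring
      rw [hg, if_pos hj]
      linarith
    · have hg : gain h (f n) ((hedgeStrategy h j).move f x n) (x n) = 0 := by
        simp only [hedgeStrategy, if_neg hj]
        exact gain_zero _ _ _
      rw [hg, if_neg hj]
      have : 0 ≤ 1 / (1 + totalRho h f (n + 1)) ^ 2 * rho h f n := by positivity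
      linarith

theorem canForceFrom_summable_payoff {h : ℝ → ℝ} (hh : IsExtraHedge h) (j : ℕ) :
    CanForceFrom h j fun f x => Summable (rho h f) → Summable (payoff h f x) := by
  refine ⟨hedgeStrategy h j, fun f x n hn => if_neg (not_le.2 hn), fun f x hf => ?_⟩
  have hR : ∀ n, 0 ≤ totalRho h f n := fun n => Finset.sum_nonneg fun i _ => rho_nonneg hh (hf i)
  have hu : ∀ i, 0 ≤ if j ≤ i then payoff h f x i else 0 := fun i => by
    split_ifs
    · exact payoff_nonneg hh
    · exact le_rfl
  constructor
  · intro n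
    refine le_trans ?_ (capital_hedgeStrategy_ge hh j x hf n)
    have := hR n
    exact add_nonneg (by positivity)
      (Finset.sum_nonneg fun i _ => mul_nonneg (by positivity) (hu i))
  by_contra hcon
  obtain ⟨hcon, hnt⟩ := not_or.1 hcon
  obtain ⟨hsum, hns⟩ := Classical.not_imp.1 hcon
  refine hnt ?_
  have hns' : ¬ Summable fun i => if j ≤ i then payoff h f x i else 0 := by
    intro hs
    refine hns ((summable_nat_add_iff j).1 ?_)
    refine ((summable_nat_add_iff j).2 hs).congr fun i => ?_
    simp
  rw [not_summable_iff_tendsto_nat_atTop_of_nonneg hu] at hns'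
  -- Summable prices keep the stakes above this positive constant, so a divergent payoff series
  -- carries the capital to infinity.
  have hg0 : 0 < 1 / (1 + ∑' i, rho h f i) ^ 2 := by
    have : 0 ≤ ∑' i, rho h f i := tsum_nonneg fun i => rho_nonneg hh (hf i)
    positivity
  refine tendsto_atTop_mono (fun n => ?_) (hns'.const_mul_atTop hg0)
  refine le_trans ?_ (capital_hedgeStrategy_ge hh j x hf n)
  have h1 : 0 ≤ 1 / (1 + totalRho h f n) := by have := hR n; positivity
  have h2 : 1 / (1 + ∑' i, rho h f i) ^ 2 * ∑ i ∈ Finset.range n,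
      (if j ≤ i then payoff h f x i else 0) ≤ ∑ i ∈ Finset.range n,
      1 / (1 + totalRho h f (i + 1)) ^ 2 * (if j ≤ i then payoff h f x i else 0) := by
    rw [Finset.mul_sum]
    refine Finset.sum_le_sum fun i _ => mul_le_mul_of_nonneg_right ?_ (hu i)
    have := hR (i + 1)
    gcongr
    exact hsum.sum_le_tsum _ fun i _ => rho_nonneg hh (hf i)
  linarith

/-! ### Behaviour of late stages on regular paths. -/

/-- The regular paths, to which the asymptotic arguments apply. -/
structure IsRegular (h : ℝ → ℝ) (f : ℕ → ForecasterMove) (x : ℕ → ℝ) : Prop where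
  legal : ∀ i, (f i).IsLegal h
  tendsto_A : Tendsto (A f) atTop atTop
  summable_rho : Summable (rho h f)
  summable_payoff : Summable (payoff h f x)

/-- The first round whose stage is at least `k`. -/
noncomputable def entry (j : ℕ) (f : ℕ → ForecasterMove) (k : ℕ) : ℕ :=
  sInf {n | k ≤ stage j f n}

section Regular

variable {h : ℝ → ℝ} {f : ℕ → ForecasterMove} {x : ℕ → ℝ} {j k n : ℕ}

theorem stage_mono (hf : ∀ i, (f i).IsLegal h) : Monotone (stage j f) := by
  intro m n hmn
  rcases (A_nonneg hf (m + 1)).eq_or_lt with h0 | h0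
  · simp [stage, ← h0]
  · refine Nat.floor_le_floor (div_le_div_of_nonneg_right ?_ (lam_pos j).le)
    exact Real.log_le_log h0 (A_mono hf (by omega))

namespace IsRegular

theorem tendsto_stage (hr : IsRegular h f x) : Tendsto (stage j f) atTop atTop := by
  refine tendsto_nat_floor_atTop.comp ?_
  exact (Real.tendsto_log_atTop.comp (hr.tendsto_A.comp (tendsto_add_atTop_nat 1))).atTop_div_const
    (lam_pos j)

theorem entry_le_iff (hr : IsRegular h f x) : entry j f k ≤ n ↔ k ≤ stage j f n := by
  have hne : {n | k ≤ stage j f n}.Nonempty := (hr.tendsto_stage.eventually_ge_atTop k).exists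
  constructor
  · intro hn
    have h1 : entry j f k ∈ {n | k ≤ stage j f n} := Nat.sInf_mem hne
    exact le_trans h1 (stage_mono hr.legal hn)
  · intro hn
    exact Nat.sInf_le hn

theorem mem_Ico_entry (hr : IsRegular h f x) :
    n ∈ Finset.Ico (entry j f k) (entry j f (k + 1)) ↔ stage j f n = k := by
  rw [Finset.mem_Ico, hr.entry_le_iff, ← not_le, hr.entry_le_iff]
  omega

theorem entry_mono (hr : IsRegular h f x) : Monotone (entry j f) := fun _ _ hkl =>
  hr.entry_le_iff.2 (hkl.trans (hr.entry_le_iff.1 le_rfl))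

theorem tendsto_entry (hr : IsRegular h f x) : Tendsto (entry j f) atTop atTop := by
  refine tendsto_atTop.2 fun n => ?_
  filter_upwards [eventually_gt_atTop (stage j f n)] with k hk
  by_contra hlt
  have := hr.entry_le_iff.1 (not_le.1 hlt).le
  omega

theorem A_entry_le (hr : IsRegular h f x) : A f (entry j f k) ≤ Real.exp (lam j * k) := by
  rcases Nat.eq_zero_or_pos (entry j f k) with h0 | h0
  · rw [h0]; simpa [A] using (Real.exp_pos _).le
  · obtain ⟨m, hm⟩ := Nat.exists_eq_succ_of_ne_zero h0.ne'
    have h1 : stage j f m < k := by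
      rw [← not_le, ← hr.entry_le_iff]; omega
    rw [hm]
    refine (lt_horizon hr.legal (rfl : stage j f m = _)).le.trans (Real.exp_le_exp.2 ?_)
    have : ((stage j f m : ℕ) : ℝ) + 1 ≤ k := by exact_mod_cast h1
    exact mul_le_mul_of_nonneg_left this (lam_pos j).le

/-- Late payoffs are small, which keeps the main factors positive, and the tail of the price series
fits into the budget; so no stopping condition triggers. -/
theorem eventually_active (hh : IsExtraHedge h) (hr : IsRegular h f x) :
    ∀ᶠ k in atTop, ∀ i, stage j f i = k →
      Active h f x j k i ∧ |dev f x i| ≤ b f (i + 1) / 2 := by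
  have h1 : ∀ᶠ n in atTop, payoff h f x n < 1 / 1000 :=
    hr.summable_payoff.tendsto_atTop_zero.eventually_lt_const (by norm_num)
  have h2 : ∀ᶠ n in atTop, ∑' i, rho h f i - 1 / 100000 < ∑ i ∈ Finset.range n, rho h f i :=
    hr.summable_rho.hasSum.tendsto_sum_nat.eventually_const_lt (by norm_num)
  obtain ⟨N, hN⟩ := (eventually_atTop.1 (h1.and (h2.and (eventually_ge_atTop j))))
  filter_upwards [eventually_gt_atTop (stage j f N), eventually_ge_atTop 2] with k hk hk2 i hi
  have hlarge : ∀ l, stage j f l = k → N < l := by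
    intro l hl
    by_contra hle
    have := stage_mono (j := j) hr.legal (not_lt.1 hle)
    omega
  have htail : ∀ t : Finset ℕ, (∀ l ∈ t, stage j f l = k) →
      ∑ l ∈ t, rho h f l ≤ 1 / 100000 := by
    intro t ht
    have hdisj : Disjoint t (Finset.range N) := by
      rw [Finset.disjoint_left]
      intro l hl hl'
      have := hlarge l (ht l hl)
      have := Finset.mem_range.1 hl'
      omega
    have h3 := hr.summable_rho.sum_le_tsum (t ∪ Finset.range N)
      fun i _ => rho_nonneg hh (hr.legal i)
    rw [Finset.sum_union hdisj] at h3
    linarith [(hN N le_rfl).2.1]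
  have hρ : ∀ l, stage j f l = k → rho h f l ≤ 1 / 100000 := fun l hl => by
    simpa using htail {l} (by simpa using hl)
  have hpos : ∀ l, stage j f l = k → 0 < fac h f x (kappa j k) (-40) l := fun l hl =>
    fac_pos_of_payoff_le hh (hr.legal l) (b_pos_of_stage hr.legal hl hk2)
      (mul_b_le_two hr.legal hl hk2 abs_kappa_le) (hρ l hl) (hN l (hlarge l hl).le).1.le
  exact ⟨⟨hi, hk2, (hN N le_rfl).2.2.trans (hlarge i hi).le, fun l _ hl => hpos l hl,
    htail _ fun l hl => (Finset.mem_filter.1 hl).2⟩,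
    abs_dev_le_of_fac_pos hh (hr.legal i) (b_pos_of_stage hr.legal hi hk2)
      (mul_b_le_two hr.legal hi hk2 abs_kappa_le) (hρ i hi) (hpos i hi)⟩

theorem activeSet_eq (hr : IsRegular h f x) (ha : ∀ i, stage j f i = k → Active h f x j k i)
    (hn : entry j f (k + 1) ≤ n) :
    activeSet h f x j k n = Finset.Ico (entry j f k) (entry j f (k + 1)) := by
  ext i
  rw [mem_activeSet, hr.mem_Ico_entry]
  constructor
  · exact fun hi => hi.2.1
  · intro hi
    refine ⟨?_, ha i hi⟩
    have := (Finset.mem_Ico.1 (hr.mem_Ico_entry.2 hi)).2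
    omega

theorem sum_dev_Ico (hr : IsRegular h f x) :
    ∑ i ∈ Finset.Ico (entry j f k) (entry j f (k + 1)), dev f x i =
      S f x (entry j f (k + 1)) - S f x (entry j f k) :=
  Finset.sum_Ico_eq_sub _ (hr.entry_mono (Nat.le_succ k))

theorem sum_v_Ico (hr : IsRegular h f x) :
    ∑ i ∈ Finset.Ico (entry j f k) (entry j f (k + 1)), (f i).v =
      A f (entry j f (k + 1)) - A f (entry j f k) :=
  Finset.sum_Ico_eq_sub _ (hr.entry_mono (Nat.le_succ k))

/-- Prices tend to zero, hence so does $\sqrt{v_n}/b$ by `cube_sqrt_div_le`, while $b^2\le A$. So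
`A` has no large relative jumps. -/
theorem eventually_v_le (hh : IsExtraHedge h) (hr : IsRegular h f x) {ε : ℝ} (hε : 0 < ε) :
    ∀ᶠ n in atTop, (f n).v ≤ ε * A f (n + 1) := by
  have h1 : ∀ᶠ n in atTop, rho h f n < min (1 / 2) (√ε ^ 3 / 2) :=
    hr.summable_rho.tendsto_atTop_zero.eventually_lt_const (by positivity)
  filter_upwards [h1, hr.tendsto_stage (j := 0) |>.eventually_ge_atTop 3] with n hn hk
  have hB := b_pos_of_stage hr.legal (rfl : stage 0 f n = stage 0 f n) (by omega)
  have hc := cube_sqrt_div_le hh (hr.legal n) hB (hn.le.trans (min_le_left _ _))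
  have hc2 : √(f n).v / b f (n + 1) ≤ √ε := by
    refine le_of_pow_le_pow_left₀ three_ne_zero (Real.sqrt_nonneg _) (hc.trans ?_)
    have := hn.le.trans (min_le_right _ _)
    have : 0 ≤ √ε ^ 3 := by positivity
    linarith
  rw [div_le_iff₀ hB] at hc2
  have hLL : 1 ≤ Real.log (Real.log (A f (n + 1))) := by
    refine le_trans ?_ (log_le_log_log_A (rfl : stage 0 f n = stage 0 f n) (by omega))
    rw [Real.le_log_iff_exp_le (by exact_mod_cast (by omega : 0 < stage 0 f n))]
    have : (3 : ℝ) ≤ stage 0 f n := by exact_mod_cast hk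
    linarith [Real.exp_one_lt_d9]
  have hA := A_nonneg hr.legal (n + 1)
  calc (f n).v = √(f n).v ^ 2 := (Real.sq_sqrt (hr.legal n).1).symm
    _ ≤ (√ε * b f (n + 1)) ^ 2 := by gcongr
    _ = ε * (A f (n + 1) / Real.log (Real.log (A f (n + 1)))) := by
        rw [mul_pow, Real.sq_sqrt hε.le, b, Real.sq_sqrt (div_nonneg hA (by linarith))]
    _ ≤ ε * A f (n + 1) := by
        gcongr
        exact div_le_self hA hLL

theorem exp_neg_lam_le (j : ℕ) : Real.exp (-lam j) ≤ delta j / 40 := by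
  have h1 : delta j / 40 = 1 / lam j := by
    unfold delta lam; rw [div_div, mul_comm]
  rw [Real.exp_neg, h1, ← one_div]
  have := lam_pos j
  gcongr
  linarith [Real.add_one_le_exp (lam j)]

/-- At the end of the stage `A` is within a small relative jump of the horizon; at its start `A` is
at most $e^{-\lambda}T\le\delta T/40$. -/
theorem eventually_le_sum_v (hh : IsExtraHedge h) (hr : IsRegular h f x) :
    ∀ᶠ k in atTop, (1 - delta j) * horizon j k ≤
      A f (entry j f (k + 1)) - A f (entry j f k) := by
  have hd := delta_pos j
  have h1 := (hr.tendsto_entry (j := j)).eventually (hr.eventually_v_le hh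
    (show 0 < delta j / 4 by positivity))
  have h2 := (tendsto_add_atTop_nat 1).eventually h1
  filter_upwards [h2] with k hk
  -- Round `n` is the first beyond stage `k`: `A f n` omits its variance, while `A f (n + 1)`
  -- already reaches the horizon.
  set n := entry j f (k + 1)
  have h3 : k + 1 ≤ stage j f n := hr.entry_le_iff.1 le_rfl
  have h4 : horizon j k ≤ A f (n + 1) := by
    refine le_trans (Real.exp_le_exp.2 ?_) (exp_le_A hr.legal (rfl : stage j f n = _) (by omega))
    have : ((k : ℝ) + 1) ≤ stage j f n := by exact_mod_cast h3
    exact mul_le_mul_of_nonneg_left this (lam_pos j).le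
  have h5 : A f (n + 1) = A f n + (f n).v := Finset.sum_range_succ _ _
  have h6 : A f (entry j f k) ≤ delta j / 40 * horizon j k := by
    refine hr.A_entry_le.trans ?_
    have : Real.exp (lam j * k) = Real.exp (-lam j) * horizon j k := by
      rw [horizon, ← Real.exp_add]; congr 1; ring
    rw [this]
    exact mul_le_mul_of_nonneg_right (exp_neg_lam_le j) (horizon_pos j k).le
  have hT := horizon_pos j k
  have hd1 := delta_le j
  have h7 : (1 - delta j / 4) * horizon j k ≤ (1 - delta j / 4) * A f (n + 1) := by
    gcongr
    linarith
  nlinarith [mul_pos hd hT]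

end IsRegular

end Regular

/-! ### Forcing late decrements to be moderate. -/

theorem smul_move_zero (c : ℝ) : c • (0 : SkepticMove) = 0 := by
  change (⟨c * 0, c * 0, c * 0⟩ : SkepticMove) = ⟨0, 0, 0⟩
  simp

theorem add_move_zero : (0 : SkepticMove) + 0 = 0 := by
  change (⟨0 + 0, 0 + 0, 0 + 0⟩ : SkepticMove) = ⟨0, 0, 0⟩
  simp

/-- The fraction of the capital set aside for the bet on a large decrement in stage `k`. -/
noncomputable def weight (k : ℕ) : ℝ := 1 / ((k + 1) * (k + 2))

theorem weight_pos (k : ℕ) : 0 < weight k := by unfold weight; positivity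

theorem sum_weight_le (K : ℕ) : ∑ k ∈ Finset.range K, weight k ≤ 1 := by
  have : ∑ k ∈ Finset.range K, weight k = 1 - 1 / (K + 1) := by
    induction K with
    | zero => simp
    | succ K ih =>
      rw [Finset.sum_range_succ, ih, weight]
      push_cast
      field_simp
      ring
  rw [this]
  have : (0 : ℝ) ≤ 1 / (K + 1) := by positivity
  linarith

/-- Skeptic's strategy that bets in every stage on a large decrement. -/
noncomputable def decrementStrategy (h : ℝ → ℝ) (j : ℕ) : SkepticStrategy where
  move f x n := weight (stage j f n) •
    prodFacMove h f x j (-(2 * scale j (stage j f n))) 40 (stage j f n) n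
  nonanticipating f f' x x' n hf hx := by
    rw [stage_congr hf, prodFacMove_congr hf hx]

section Decrement

variable {h : ℝ → ℝ} {f : ℕ → ForecasterMove} {x : ℕ → ℝ} {j k n : ℕ}

theorem capital_decrementStrategy (K : ℕ) (hK : ∀ i < n, stage j f i < K) :
    capital h (decrementStrategy h j) f x n = 1 + ∑ k ∈ Finset.range K,
      weight k * (prodFac h f x j (-(2 * scale j k)) 40 k n - 1) := by
  induction n with
  | zero =>
    rw [capital, Finset.sum_eq_zero, add_zero]
    intro k _
    rw [prodFac_eq_one (by simp), sub_self, mul_zero]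
  | succ n ih =>
    rw [capital, ih fun i hi => hK i (by omega)]
    have hsum : ∑ k ∈ Finset.range K,
        weight k * gain h (f n) (prodFacMove h f x j (-(2 * scale j k)) 40 k n) (x n) =
        gain h (f n) ((decrementStrategy h j).move f x n) (x n) := by
      rw [Finset.sum_eq_single (stage j f n)]
      · exact (gain_smul _ _ _ _ _).symm
      · intro k _ hk
        rw [prodFacMove, if_neg fun ha => hk ha.1.symm, gain_zero, mul_zero]
      · intro hnot
        exact absurd (Finset.mem_range.2 (hK n (Nat.lt_succ_self n))) hnot
    rw [← hsum, add_assoc, ← Finset.sum_add_distrib]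
    congr 1
    refine Finset.sum_congr rfl fun k _ => ?_
    rw [prodFac_succ]
    ring

theorem abs_neg_two_scale : |-(2 * scale j k)| ≤ 2 * scale j k := by
  rw [abs_neg, abs_of_nonneg (mul_nonneg zero_le_two (scale_nonneg j k))]

/-- The initial unit covers the total of the weights, so the capital dominates any partial sum of
weighted products. -/
theorem sum_le_capital_decrementStrategy (hh : IsExtraHedge h) (hf : ∀ i, (f i).IsLegal h)
    (t : Finset ℕ) :
    ∑ k ∈ t, weight k * prodFac h f x j (-(2 * scale j k)) 40 k n ≤
      capital h (decrementStrategy h j) f x n := by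
  have hp : ∀ k, 0 ≤ weight k * prodFac h f x j (-(2 * scale j k)) 40 k n := fun k =>
    mul_nonneg (weight_pos k).le (prodFac_nonneg hh hf abs_neg_two_scale)
  set K := (stage j f n + 1) + (t.sup id + 1)
  have hK : ∀ i < n, stage j f i < K := fun i hi => by
    have := stage_mono (j := j) hf hi.le
    omega
  rw [capital_decrementStrategy K hK]
  simp only [mul_sub, mul_one, Finset.sum_sub_distrib]
  have h1 : ∑ k ∈ t, weight k * prodFac h f x j (-(2 * scale j k)) 40 k n ≤
      ∑ k ∈ Finset.range K, weight k * prodFac h f x j (-(2 * scale j k)) 40 k n := by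
    refine Finset.sum_le_sum_of_subset_of_nonneg (fun k hk => ?_) fun k _ _ => hp k
    have : k ≤ t.sup id := Finset.le_sup (f := id) hk
    exact Finset.mem_range.2 (by omega)
  linarith [sum_weight_le K]

/-- With $\theta=-2\sqrt{\ln k/T}$ the exponent is at least $6\ln k-2\ln k$, so the product is at
least $k^4/2$, more than the reciprocal weight. This gain persists after the stage. -/
theorem IsRegular.one_le_weight_mul (hh : IsExtraHedge h) (hr : IsRegular h f x)
    (hk : 3 ≤ k) (ha : ∀ i, stage j f i = k →
      Active h f x j k i ∧ |dev f x i| ≤ b f (i + 1) / 2)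
    (hs : S f x (entry j f (k + 1)) - S f x (entry j f k) ≤ -(3 * (scale j k * horizon j k)))
    (hn : entry j f (k + 1) ≤ n) :
    1 ≤ weight k * prodFac h f x j (-(2 * scale j k)) 40 k n := by
  have hset := hr.activeSet_eq (fun i hi => (ha i hi).1) hn
  have hpos : ∀ i ∈ activeSet h f x j k n, |dev f x i| ≤ b f (i + 1) / 2 :=
    fun i hi => (ha i (mem_activeSet.1 hi).2.1).2
  have h1 := exp_le_prodFac hh hr.legal (abs_neg_two_scale (j := j) (k := k)) hpos
  have hv := sum_v_activeSet_le hr.legal (x := x) (j := j) (k := k) (n := n)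
  rw [hset, hr.sum_dev_Ico] at h1
  rw [hset] at hv
  set a := ∑ i ∈ Finset.Ico (entry j f k) (entry j f (k + 1)), (f i).v
  have hsc := scale_nonneg j k
  have hT := scale_sq j k
  have h2 : 4 * Real.log k - 1 / 100 ≤ -(2 * scale j k) *
      (S f x (entry j f (k + 1)) - S f x (entry j f k)) - (-(2 * scale j k)) ^ 2 / 2 * a
      - 1 / 100 := by
    have e1 := mul_le_mul_of_nonneg_left hs (mul_nonneg zero_le_two hsc)
    have e2 := mul_le_mul_of_nonneg_left hv (mul_nonneg zero_le_two (sq_nonneg (scale j k)))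
    nlinarith
  have hk3 : (3 : ℝ) ≤ k := by exact_mod_cast hk
  have h3 : (k : ℝ) ^ 4 / 2 ≤ prodFac h f x j (-(2 * scale j k)) 40 k n := by
    refine le_trans ?_ ((Real.exp_le_exp.2 h2).trans h1)
    rw [sub_eq_add_neg, Real.exp_add, show 4 * Real.log k = (4 : ℕ) * Real.log k by norm_num,
      Real.exp_nat_mul, Real.exp_log (by linarith), div_eq_mul_inv]
    gcongr
    have := Real.add_one_le_exp (-(1 / 100 : ℝ))
    norm_num at this ⊢
    linarith
  rw [weight, div_mul_eq_mul_div, one_mul, one_le_div (by positivity)]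
  refine le_trans ?_ h3
  nlinarith [pow_le_pow_left₀ (by norm_num) hk3 2, pow_le_pow_left₀ (by norm_num) hk3 3]

/-- Skeptic can force that the decrements in the late stages are not large. -/
theorem canForceFrom_decrement (hh : IsExtraHedge h) (j : ℕ) :
    CanForceFrom h j fun f x => IsRegular h f x → ∀ᶠ k in atTop,
      -(3 * (scale j k * horizon j k)) ≤ S f x (entry j f (k + 1)) - S f x (entry j f k) := by
  refine ⟨decrementStrategy h j, fun f x n hn => ?_, fun f x hf => ⟨fun n => ?_, ?_⟩⟩
  · change weight _ • prodFacMove h f x j _ 40 _ n = 0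
    rw [prodFacMove_eq_zero hn, smul_move_zero]
  · simpa using sum_le_capital_decrementStrategy hh hf (x := x) (n := n) (j := j) ∅
  by_contra hcon
  obtain ⟨hcon, hnt⟩ := not_or.1 hcon
  obtain ⟨hr, hfreq⟩ := Classical.not_imp.1 hcon
  refine hnt ?_
  have hfreq' : ∃ᶠ k in atTop, ∀ n, entry j f (k + 1) ≤ n →
      1 ≤ weight k * prodFac h f x j (-(2 * scale j k)) 40 k n := by
    refine ((not_eventually.1 hfreq).and_eventually
      ((hr.eventually_active (j := j) hh).and (eventually_ge_atTop 3))).mono ?_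
    rintro k ⟨hs, ha, hk⟩ n hn
    exact hr.one_le_weight_mul hh hk ha (not_le.1 hs).le hn
  have hinf := Nat.frequently_atTop_iff_infinite.1 hfreq'
  refine tendsto_atTop.2 fun r => ?_
  obtain ⟨m, hm⟩ := exists_nat_ge r
  obtain ⟨t, ht, htm⟩ := hinf.exists_subset_card_eq m
  filter_upwards [eventually_ge_atTop (entry j f (t.sup id + 1))] with n hn
  refine le_trans ?_ (sum_le_capital_decrementStrategy hh hf (j := j) t)
  refine hm.trans ?_
  rw [← htm, ← nsmul_one, ← Finset.sum_const]
  refine Finset.sum_le_sum fun k hk => ht hk n (le_trans (hr.entry_mono ?_) hn)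
  exact Nat.succ_le_succ (Finset.le_sup (f := id) hk)

end Decrement

/-! ### Forcing infinitely many large increments. -/

/-- The move whose gain is the increment of `phi`. -/
noncomputable def phiMove (h : ℝ → ℝ) (f : ℕ → ForecasterMove) (x : ℕ → ℝ) (j k n : ℕ) :
    SkepticMove :=
  (-(1 / (2 * peakBound j k))) • (prodFacMove h f x j (kappa j k) (-40) k n +
    (-(1 / 3) : ℝ) • (prodFacMove h f x j (kappa j k * (1 + delta j)) 40 k n +
      prodFacMove h f x j (kappa j k * (1 - delta j)) 40 k n))

/-- Skeptic's strategy that bets in every stage against a large increment. -/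
noncomputable def incrementStrategy (h : ℝ → ℝ) (j : ℕ) : SkepticStrategy where
  move f x n := (∏ k ∈ Finset.range (stage j f n), phi h f x j k n) •
    phiMove h f x j (stage j f n) n
  nonanticipating f f' x x' n hf hx := by
    simp only [phiMove, stage_congr hf, prodFacMove_congr hf hx,
      fun k => phi_congr (h := h) (j := j) (k := k) (fun i hi => hf i (le_of_lt hi)) hx]

section Increment

variable {h : ℝ → ℝ} {f : ℕ → ForecasterMove} {x : ℕ → ℝ} {j k n : ℕ}

theorem phi_succ : phi h f x j k (n + 1) =
    phi h f x j k n + gain h (f n) (phiMove h f x j k n) (x n) := by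
  simp only [phi, peak, phiMove, gain_smul, gain_add, prodFac_succ]
  ring

theorem phi_succ_of_ne (hk : stage j f n ≠ k) : phi h f x j k (n + 1) = phi h f x j k n := by
  have ha : ¬ Active h f x j k n := fun ha => hk ha.1
  simp only [phi, peak, prodFac_succ_of_not_active ha]

theorem half_le_phi (hh : IsExtraHedge h) (hf : ∀ i, (f i).IsLegal h) :
    1 / 2 ≤ phi h f x j k n := by
  rcases Nat.eq_zero_or_pos k with rfl | hk
  -- In stage 0 `peakBound` is 0, and division by zero makes `phi` equal to 1.
  · norm_num [phi, peakBound]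
  · exact half_le_phi_of_one_le hh hf hk

/-- Each stage reinvests the capital left by the preceding ones, and stages not yet reached
contribute a factor 1. -/
theorem capital_incrementStrategy (hf : ∀ i, (f i).IsLegal h) (K : ℕ)
    (hK : ∀ i < n, stage j f i < K) :
    capital h (incrementStrategy h j) f x n = ∏ k ∈ Finset.range K, phi h f x j k n := by
  induction n generalizing K with
  | zero =>
    rw [capital, Finset.prod_eq_one]
    intro k _
    exact phi_eq_one (by simp)
  | succ n ih =>
    have hmono : ∀ i ≤ n, stage j f i ≤ stage j f n := fun i hi => stage_mono hf hi
    have hsub : Finset.range (stage j f n + 1) ⊆ Finset.range K := by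
      intro k hk
      have := hK n (Nat.lt_succ_self n)
      rw [Finset.mem_range] at *
      omega
    rw [← Finset.prod_subset hsub, Finset.prod_range_succ, phi_succ, capital,
      ih (stage j f n + 1) fun i hi => Nat.lt_succ_of_le (hmono i hi.le),
      Finset.prod_range_succ]
    · have hprod : ∏ k ∈ Finset.range (stage j f n), phi h f x j k (n + 1) =
          ∏ k ∈ Finset.range (stage j f n), phi h f x j k n :=
        Finset.prod_congr rfl fun k hk => phi_succ_of_ne (Finset.mem_range.1 hk).ne'
      rw [hprod, mul_add]
      congr 1
      exact gain_smul _ _ _ _ _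
    · intro k _ hk
      refine phi_eq_one fun i hi => ?_
      have := hmono i (Nat.lt_succ_iff.1 hi)
      rw [Finset.mem_range] at hk
      omega

theorem tendsto_prod_of_not_summable {a : ℕ → ℝ} (ha0 : ∀ k, 0 ≤ a k) (ha : ¬ Summable a)
    (K : ℕ) : Tendsto (fun m => ∏ k ∈ Finset.range m, if k < K then 1 / 2 else 1 + a k)
      atTop atTop := by
  rw [← tendsto_add_atTop_iff_nat K]
  have h1 : ¬ Summable fun i => a (K + i) := by
    simp_rw [add_comm K]
    rwa [summable_nat_add_iff K]
  rw [not_summable_iff_tendsto_nat_atTop_of_nonneg fun i => ha0 _] at h1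
  have hpos : (0 : ℝ) < (1 / 2) ^ K := by positivity
  refine tendsto_atTop_mono (fun m => ?_) (h1.const_mul_atTop hpos)
  rw [add_comm m K, Finset.prod_range_add]
  have e1 : ∏ k ∈ Finset.range K, (if k < K then 1 / 2 else 1 + a k) = (1 / 2 : ℝ) ^ K := by
    rw [Finset.prod_congr rfl fun k hk => if_pos (Finset.mem_range.1 hk)]
    simp
  have e2 : 1 + ∑ i ∈ Finset.range m, a (K + i) ≤
      ∏ i ∈ Finset.range m, (if K + i < K then 1 / 2 else 1 + a (K + i)) := by
    induction m with
    | zero => simp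
    | succ m ih =>
      rw [Finset.sum_range_succ, Finset.prod_range_succ, if_neg (by omega)]
      have hs : 0 ≤ ∑ i ∈ Finset.range m, a (K + i) := Finset.sum_nonneg fun i _ => ha0 _
      have := mul_le_mul_of_nonneg_right ih (show 0 ≤ 1 + a (K + m) by linarith [ha0 (K + m)])
      nlinarith [mul_nonneg hs (ha0 (K + m))]
  rw [e1]
  gcongr
  linarith

/-- Skeptic can force that infinitely many stages have a large increment. -/
theorem canForceFrom_increment (hh : IsExtraHedge h) (j : ℕ) :
    CanForceFrom h j fun f x => IsRegular h f x → ∃ᶠ k in atTop,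
      (1 - 5 * delta j) * (√2 * scale j k * horizon j k) <
        S f x (entry j f (k + 1)) - S f x (entry j f k) := by
  refine ⟨incrementStrategy h j, fun f x n hn => ?_, fun f x hf => ?_⟩
  · change (∏ k ∈ Finset.range (stage j f n), phi h f x j k n) • phiMove h f x j _ n = 0
    simp only [phiMove, prodFacMove_eq_zero hn, smul_move_zero, add_move_zero]
  have hcap : ∀ n, capital h (incrementStrategy h j) f x n =
      ∏ k ∈ Finset.range (stage j f n + 1), phi h f x j k n := fun n =>
    capital_incrementStrategy hf _ fun i hi => Nat.lt_succ_of_le (stage_mono hf hi.le)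
  have hhalf : ∀ k n, 1 / 2 ≤ phi h f x j k n := fun k n => half_le_phi hh hf
  refine ⟨fun n => ?_, ?_⟩
  · rw [hcap]
    exact Finset.prod_nonneg fun k _ => by linarith [hhalf k n]
  by_contra hcon
  obtain ⟨hcon, hnt⟩ := not_or.1 hcon
  obtain ⟨hr, hfreq⟩ := Classical.not_imp.1 hcon
  refine hnt ?_
  have hd := delta_pos j
  have hlog : ∀ᶠ k : ℕ in atTop, 2 ≤ delta j ^ 2 * Real.log k :=
    ((Real.tendsto_log_atTop.comp tendsto_natCast_atTop_atTop).const_mul_atTop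
      (show 0 < delta j ^ 2 by positivity)).eventually_ge_atTop 2
  have hev : ∀ᶠ k in atTop, ∀ n, entry j f (k + 1) ≤ n →
      1 + 1 / (6 * peakBound j k) ≤ phi h f x j k n := by
    filter_upwards [not_frequently.1 hfreq, hr.eventually_active (j := j) hh,
      hr.eventually_le_sum_v (j := j) hh, hlog, eventually_ge_atTop 1] with k hs ha hv hL hk n hn
    have hset := hr.activeSet_eq (fun i hi => (ha i hi).1) hn
    refine one_add_le_phi hk (peak_nonpos hh hf ?_ hL ?_)
    · rwa [hset, hr.sum_v_Ico]
    · rw [hset, hr.sum_dev_Ico]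
      exact not_lt.1 hs
  obtain ⟨K, hK⟩ := eventually_atTop.1 hev
  have hM0 : ∀ k, 0 ≤ 1 / (6 * peakBound j k) := fun k => by unfold peakBound; positivity
  -- `peakBound` is linear in `k`, so this is the divergence of the harmonic series.
  have hns : ¬ Summable fun k => 1 / (6 * peakBound j k) := by
    intro hs
    refine Real.not_summable_one_div_natCast ((hs.mul_left (6 * Real.exp (2 / delta j + 1))).congr
      fun k => ?_)
    have := Real.exp_pos (2 / delta j + 1)
    rw [peakBound, ← mul_assoc, mul_one_div, div_mul_cancel_left₀ (by positivity), one_div]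
  -- The division by 2 accounts for the unfinished current stage, whose factor is only known to be
  -- at least $1/2$.
  have ht := ((tendsto_prod_of_not_summable hM0 hns K).comp
    (hr.tendsto_stage (j := j))).atTop_div_const two_pos
  refine tendsto_atTop_mono (fun n => ?_) ht
  rw [hcap, Finset.prod_range_succ, div_eq_mul_one_div]
  have hc0 : ∀ k, 0 ≤ if k < K then (1 / 2 : ℝ) else 1 + 1 / (6 * peakBound j k) := fun k => by
    have := hM0 k
    split_ifs <;> linarith
  refine mul_le_mul ?_ (hhalf _ n) (by norm_num)
    (Finset.prod_nonneg fun k _ => by linarith [hhalf k n])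
  refine Finset.prod_le_prod (fun k _ => hc0 k) fun k hk => ?_
  split_ifs with hlt
  · exact hhalf k n
  · exact hK k (not_lt.1 hlt) n (hr.entry_le_iff.2 (Finset.mem_range.1 hk))

end Increment

/-! ### From stage increments to the limit superior. -/

theorem scale_mul_horizon (j k : ℕ) :
    scale j k * horizon j k = √(Real.log k * horizon j k) := by
  have hT := horizon_pos j k
  rw [scale, eq_comm, Real.sqrt_eq_iff_mul_self_eq (mul_nonneg (Real.log_natCast_nonneg k) hT.le)
    (by positivity), mul_mul_mul_comm, Real.mul_self_sqrt
    (div_nonneg (Real.log_natCast_nonneg k) hT.le)]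
  field_simp

theorem tendsto_scale_mul_horizon (j : ℕ) :
    Tendsto (fun k => scale j k * horizon j k) atTop atTop := by
  have h1 : Tendsto (fun k : ℕ => √(Real.log k)) atTop atTop :=
    Real.tendsto_sqrt_atTop.comp (Real.tendsto_log_atTop.comp tendsto_natCast_atTop_atTop)
  refine tendsto_atTop_mono (fun k => ?_) h1
  rw [scale_mul_horizon]
  apply Real.sqrt_le_sqrt
  have : 1 ≤ horizon j k := Real.one_le_exp (by have := lam_pos j; positivity)
  nlinarith [Real.log_natCast_nonneg k]

/-- The choice $\lambda=40/\delta$ gives $\delta e^{\lambda/2}\ge20$, which makes the accumulated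
past negligible against a single stage. -/
theorem sqrt_log_mul_exp_le (j k : ℕ) :
    20 * √(Real.log k * Real.exp (lam j * k)) ≤ delta j * (scale j k * horizon j k) := by
  have hd := delta_pos j
  have h1 : scale j k * horizon j k =
      Real.exp (lam j / 2) * √(Real.log k * Real.exp (lam j * k)) := by
    have : Real.log k * horizon j k =
        Real.exp (lam j / 2) ^ 2 * (Real.log k * Real.exp (lam j * k)) := by
      rw [horizon, mul_left_comm, ← Real.exp_nat_mul, ← Real.exp_add]
      congr 2
      push_cast
      ring
    rw [scale_mul_horizon, this, Real.sqrt_mul (sq_nonneg _), Real.sqrt_sq (Real.exp_pos _).le]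
  have h2 : 20 ≤ delta j * Real.exp (lam j / 2) := by
    have h3 : delta j * (lam j / 2) = 20 := by
      unfold delta lam
      have : (j : ℝ) + 10 ≠ 0 := by positivity
      field_simp
      norm_num
    have := mul_le_mul_of_nonneg_left (Real.add_one_le_exp (lam j / 2)) hd.le
    linarith
  rw [h1, ← mul_assoc]
  gcongr

theorem scale_mul_horizon_le_succ (j : ℕ) {k : ℕ} (hk : 1 ≤ k) :
    scale j k * horizon j k ≤ √(Real.log (k + 1 : ℕ) * Real.exp (lam j * (k + 1 : ℕ))) := by
  rw [scale_mul_horizon, horizon]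
  push_cast
  have : (0 : ℝ) < k := by exact_mod_cast hk
  gcongr
  linarith

theorem eventually_log_lam_le (j : ℕ) :
    ∀ᶠ k : ℕ in atTop, Real.log (lam j * (k + 1)) ≤ (1 + delta j) ^ 2 * Real.log k := by
  have hd := delta_pos j
  have h1 : ∀ᶠ k : ℕ in atTop, Real.log (2 * lam j) ≤ delta j * Real.log k :=
    ((Real.tendsto_log_atTop.comp tendsto_natCast_atTop_atTop).const_mul_atTop
      hd).eventually_ge_atTop _
  filter_upwards [h1, eventually_ge_atTop 1] with k hk hk1
  have hk1' : (1 : ℝ) ≤ k := by exact_mod_cast hk1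
  have hl := lam_pos j
  have hL := Real.log_natCast_nonneg k
  calc Real.log (lam j * (k + 1)) ≤ Real.log (2 * lam j * k) := by
        apply Real.log_le_log (by positivity)
        nlinarith
    _ = Real.log (2 * lam j) + Real.log k := Real.log_mul (by positivity) (by positivity)
    _ ≤ (1 + delta j) ^ 2 * Real.log k := by
        nlinarith [mul_nonneg hd.le hL, mul_nonneg (sq_nonneg (delta j)) hL]

section

variable {h : ℝ → ℝ} {f : ℕ → ForecasterMove} {x : ℕ → ℝ} {j : ℕ}

/-- The decrement bounds grow so fast that their sum is governed by the last term: the constant 6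
reproduces itself because $6\delta/20+3\le6$. -/
theorem IsRegular.exists_le_S_entry (hdec : ∀ᶠ k in atTop,
      -(3 * (scale j k * horizon j k)) ≤ S f x (entry j f (k + 1)) - S f x (entry j f k)) :
    ∃ c, ∀ᶠ k in atTop, c - 6 * √(Real.log (k : ℕ) * Real.exp (lam j * k)) ≤
      S f x (entry j f k) := by
  obtain ⟨K, hK⟩ := eventually_atTop.1 (hdec.and (eventually_ge_atTop 1))
  refine ⟨S f x (entry j f K), eventually_atTop.2 ⟨K, fun k hk => ?_⟩⟩
  induction k, hk using Nat.le_induction with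
  | base => linarith [Real.sqrt_nonneg (Real.log K * Real.exp (lam j * K))]
  | succ k hk ih =>
    have h1 := (hK k hk).1
    have h2 := sqrt_log_mul_exp_le j k
    have h3 := scale_mul_horizon_le_succ j (hK k hk).2
    have h4 := delta_le j
    have h5 : 0 ≤ scale j k * horizon j k := mul_nonneg (scale_nonneg j k) (horizon_pos j k).le
    nlinarith [mul_le_mul_of_nonneg_right h4 h5]

theorem IsRegular.one_le_limsup (hr : IsRegular h f x)
    (hdec : ∀ j, ∀ᶠ k in atTop,
      -(3 * (scale j k * horizon j k)) ≤ S f x (entry j f (k + 1)) - S f x (entry j f k))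
    (hinc : ∀ j, ∃ᶠ k in atTop, (1 - 5 * delta j) * (√2 * scale j k * horizon j k) <
      S f x (entry j f (k + 1)) - S f x (entry j f k)) :
    (1 : EReal) ≤ limsup (fun n : ℕ =>
      ((S f x n / √(2 * A f n * Real.log (Real.log (A f n))) : ℝ) : EReal)) atTop := by
  by_contra! hlt
  obtain ⟨r, hr1, hr2⟩ := EReal.lt_iff_exists_real_btwn.1 hlt
  have hev := eventually_lt_of_limsup_lt hr1
  have hr1' : r < 1 := by exact_mod_cast hr2
  -- Truncation at 0 allows `s` to multiply upper bounds for the denominator.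
  set s := max r 0 with hs
  have hs1 : s < 1 := max_lt hr1' one_pos
  have hs0 : 0 ≤ s := le_max_right _ _
  obtain ⟨j, hj⟩ := exists_nat_one_div_lt (show 0 < (1 - s) / 8 by linarith)
  -- The contradiction compares $1-6\delta$ with $s(1+\delta)$: then $1-s-7\delta\ge\delta$, and
  -- this last $\delta$ absorbs the constant `c`.
  have hdj : delta j ≤ (1 - s) / 8 := by
    refine le_trans ?_ hj.le
    unfold delta
    gcongr
    norm_num
  have hd := delta_pos j
  obtain ⟨c, hc⟩ := exists_le_S_entry (hdec j)
  have hentry : Tendsto (fun k => entry j f (k + 1)) atTop atTop :=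
    hr.tendsto_entry.comp (tendsto_add_atTop_nat 1)
  have hev1 : ∀ᶠ k in atTop, S f x (entry j f (k + 1)) /
      √(2 * A f (entry j f (k + 1)) * Real.log (Real.log (A f (entry j f (k + 1))))) < r :=
    hentry.eventually (hev.mono fun n hn => by exact_mod_cast hn)
  have hev2 : ∀ᶠ k in atTop, Real.exp 2 ≤ A f (entry j f (k + 1)) :=
    hentry.eventually (hr.tendsto_A.eventually_ge_atTop _)
  have hev3 : ∀ᶠ k in atTop, -c / (delta j * √2) < scale j k * horizon j k :=
    (tendsto_scale_mul_horizon j).eventually_gt_atTop _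
  obtain ⟨k, hk0, hk1, hk2, hk3, hk4, hk5⟩ := ((hinc j).and_eventually (hc.and (hev1.and (hev2.and
    (hev3.and (eventually_log_lam_le j)))))).exists
  set n := entry j f (k + 1)
  set g := scale j k * horizon j k with hg
  have hg0 : 0 ≤ g := mul_nonneg (scale_nonneg j k) (horizon_pos j k).le
  have hApos : 0 < A f n := (Real.exp_pos 2).trans_le hk3
  have hlog2 : 2 ≤ Real.log (A f n) := (Real.le_log_iff_exp_le hApos).2 hk3
  have hLLpos : 0 < Real.log (Real.log (A f n)) := Real.log_pos (by linarith)
  have hAle : A f n ≤ horizon j k := by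
    have := hr.A_entry_le (j := j) (k := k + 1)
    push_cast at this
    exact this
  have hLL : Real.log (Real.log (A f n)) ≤ (1 + delta j) ^ 2 * Real.log k := by
    refine le_trans (Real.log_le_log (by linarith) ?_) hk5
    exact (Real.log_le_iff_le_exp hApos).2 hAle
  have hden : √(2 * A f n * Real.log (Real.log (A f n))) ≤ (1 + delta j) * (√2 * g) := by
    have e1 : 2 * A f n * Real.log (Real.log (A f n)) ≤
        (1 + delta j) ^ 2 * (2 * (Real.log k * horizon j k)) := by
      have := mul_le_mul hAle hLL hLLpos.le (horizon_pos j k).le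
      linarith
    refine (Real.sqrt_le_sqrt e1).trans_eq ?_
    rw [Real.sqrt_mul (sq_nonneg _), Real.sqrt_sq (by linarith), Real.sqrt_mul zero_le_two, hg,
      scale_mul_horizon]
  have hdpos : 0 < √(2 * A f n * Real.log (Real.log (A f n))) := by positivity
  have hup : S f x n ≤ s * ((1 + delta j) * (√2 * g)) := by
    rw [div_lt_iff₀ hdpos] at hk2
    calc S f x n ≤ r * √(2 * A f n * Real.log (Real.log (A f n))) := hk2.le
      _ ≤ s * √(2 * A f n * Real.log (Real.log (A f n))) := by gcongr; exact le_max_left _ _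
      _ ≤ _ := by gcongr
  have hlow : c + (1 - 6 * delta j) * (√2 * g) ≤ S f x n := by
    have h6 := sqrt_log_mul_exp_le j k
    have h7 : (1 : ℝ) ≤ √2 := Real.one_le_sqrt.2 (by norm_num)
    have h8 : delta j * g ≤ delta j * (√2 * g) := by
      gcongr
      nlinarith
    rw [mul_assoc √2, ← hg] at hk0
    rw [← hg] at h6
    nlinarith
  have hfin : -c < delta j * √2 * g := by
    rw [div_lt_iff₀ (by positivity)] at hk4
    linarith
  have h9 : 0 ≤ √2 * g := by positivity
  have h10 : s * delta j ≤ delta j := by nlinarith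
  nlinarith [mul_le_mul_of_nonneg_right h10 h9, mul_le_mul_of_nonneg_right hdj h9]

end

end UFQSH

/-- In the protocol with quadratic and stronger hedge `h`, Skeptic can force the lower half of the
law of the iterated logarithm. Index `n` of `f` is round `n + 1` in the usual numbering, hence
`b f (n + 1)`. The finitely many `n` with `A f n ≤ e` affect neither the convergence of the
series nor the limit superior, which is taken in the extended reals. -/
theorem mainTheorem3 (h : ℝ → ℝ) (hh : UFQSH.IsExtraHedge h) :
    UFQSH.CanForce h (fun f x =>
      (Tendsto (UFQSH.A f) atTop atTop ∧
        Summable (fun n : ℕ => (f n).w / h (UFQSH.b f (n + 1)))) →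
      (1 : EReal) ≤ limsup (fun n : ℕ =>
        ((UFQSH.S f x n / √(2 * UFQSH.A f n * Real.log (Real.log (UFQSH.A f n))) : ℝ) : EReal))
        atTop) := by
  obtain ⟨σ, hσ⟩ := UFQSH.canForce_forall fun j =>
    (UFQSH.canForceFrom_summable_payoff hh j).and
      ((UFQSH.canForceFrom_decrement hh j).and (UFQSH.canForceFrom_increment hh j))
  refine ⟨σ, fun f x hf => ⟨(hσ f x hf).1, (hσ f x hf).2.imp_left fun hE hA => ?_⟩⟩
  have hr : UFQSH.IsRegular h f x := ⟨hf, hA.1, hA.2, (hE 0).1 hA.2⟩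
  exact hr.one_le_limsup (fun j => (hE j).2.1 hr) fun j => (hE j).2.2 hr
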